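/- Let $(\mathcal M,\omega)$ be a symplectic manifold of dimension $2n$ (smooth, Hausdorff, second countable), and let $E\to\mathcal M$ be a smooth bundle of $*$-algebras with fibers $A_x\cong\mathrm{End}(\mathbb C^N)$ (locally trivial as a bundle of $*$-algebras), equipped with a smooth connection $\alpha$ compatible with the $*$-algebra structure, i.e. $d_\alpha(ab)=(d_\alpha a)b+a\,d_\alpha b$ and $d_\alpha(a^*)=(d_\alpha a)^*$. Put $A=\Gamma(\mathcal M,E)$. For a smooth function $z$ let $v(z)$ be its Hamiltonian vector field, $\omega(v(z),\cdot)=dz$, and let $\{z,s\}=\iota_{v(z)}d_\alpha s$ for $s\in A$. Let $H^{(0)}\in C^\infty(\mathcal M,\mathbb R)$ be such that $v(H^{(0)})$ has a complete flow, written $x\mapsto x(t)$, and let $H^{(1)}=(H^{(1)})^*\in A$. For $s\in A$ let $s(t)\in A$, smooth in $(t,x)$, be its time evolution, i.e. the solution of $\partial_t s(t)=\{H^{(0)},s(t)\}+i[H^{(1)},s(t)]$, $s(0)=s$. Let $\mathcal U(t)\in A$, smooth in $(t,x)$, be a solution of $\partial_t\,\mathcal U(t)=\{H^{(0)},\mathcal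 U(t)\}+iH^{(1)}\mathcal U(t)$, $\mathcal U(0)=1$. For $\sigma\in A$ put $\mathbb E_\sigma(s)=\int_{\mathcal M}\mathrm{Tr}(s_x\sigma_x)\,\omega_x^n$, where $\mathrm{Tr}$ is the trace of $A_x\cong\mathrm{End}(\mathbb C^N)$. A hybrid density matrix is a section $\rho\in A$ such that every $\rho_x$ is Hermitian with nonnegative eigenvalues and $\int_{\mathcal M}\mathrm{Tr}(\rho_x)\,\omega^n_x=1$. Let $\rho$ be a hybrid density matrix. Then there is exactly one family $\rho(t)\in A$, $t\in\mathbb R$, such that $$\mathbb E_{\rho(t)}(s)=\mathbb E_\rho(s(t))$$ for all $t$ and all $s\in A$ for which the right-hand side is defined (meaning that the integrand is integrable; the left-hand side is then required to be defined as well). This family satisfies $\rho(0)=\rho$, it is smooth in $(t,x)$, every $\rho(t)$ is a hybrid density matrix, and for all $t$ and $x$ $$\frac{\partial\rho_x(t)}{\partial t}=-\{H^{(0)},\rho(t)\}_x-i\,[H^{(1)}_x,\rho_x(t)].$$ Moreover every $\mathcal U_x(t)$ is invertible, and for all $t$ and $y$ $$\rho_y(t)=h_{y,y(-t)}\,\bigl(\mathcal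 U_{y(-t)}(t)\bigr)^{-1}\rho_{y(-t)}\;\mathcal U_{y(-t)}(t)\,h_{y(-t),y},$$ where $u\mapsto h_{y,y(-t)}\,u\,h_{y(-t),y}$ denotes the $\alpha$-parallel transport $A_{y(-t)}\to A_y$ along the trajectory $\tau\mapsto y(\tau)$ from $\tau=-t$ to $\tau=0$. -/

import Mathlib

open Bundle MeasureTheory
open scoped Manifold ContDiff

noncomputable section

/-- The coordinate space `ℝ^{2n}`. -/
abbrev PhaseSpace (n : ℕ) : Type := EuclideanSpace ℝ (Fin (2 * n))

/-- The smooth (boundaryless) model of a `2n`-dimensional manifold. -/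
abbrev PhaseModel (n : ℕ) : ModelWithCorners ℝ (PhaseSpace n) (PhaseSpace n) :=
  𝓘(ℝ, PhaseSpace n)

/-- The C*-algebra `End(ℂ^N)` with its usual product and Hermitian conjugation. -/
abbrev EndC (N : ℕ) : Type := EuclideanSpace ℂ (Fin N) →L[ℂ] EuclideanSpace ℂ (Fin N)

section Symplectic

variable {n : ℕ} {M : Type*} [TopologicalSpace M] [ChartedSpace (PhaseSpace n) M]

/-- The pullback of a 2-form on `M` to the image of the preferred chart at `p`. -/
def formInChart (Ω : ∀ x : M, TangentSpace (PhaseModel n) x [⋀^Fin 2]→L[ℝ] ℝ) (p : M)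
    (u : PhaseSpace n) : PhaseSpace n [⋀^Fin 2]→L[ℝ] ℝ :=
  (Ω ((extChartAt (PhaseModel n) p).symm u)).compContinuousLinearMap
    (mfderiv (PhaseModel n) (PhaseModel n) (extChartAt (PhaseModel n) p).symm u)

variable (n M) in
/-- A symplectic form: a smooth closed nondegenerate 2-form. -/
structure SymplecticForm where
  toForm : ∀ x : M, TangentSpace (PhaseModel n) x [⋀^Fin 2]→L[ℝ] ℝ
  smooth : ∀ p : M, ContDiffOn ℝ ∞ (formInChart toForm p) (extChartAt (PhaseModel n) p).target
  closed : ∀ p : M, ∀ u ∈ (extChartAt (PhaseModel n) p).target,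
    extDeriv (formInChart toForm p) u = 0
  nondegenerate : ∀ (x : M) (v : TangentSpace (PhaseModel n) x),
    (∀ w : TangentSpace (PhaseModel n) x, toForm x ![v, w] = 0) → v = 0

namespace SymplecticForm

variable (Ω : SymplecticForm n M)

theorem exists_hamiltonian_vector (x : M) (l : TangentSpace (PhaseModel n) x →L[ℝ] ℝ) :
    ∃ v : TangentSpace (PhaseModel n) x,
      ∀ w : TangentSpace (PhaseModel n) x, Ω.toForm x ![v, w] = l w := by
  have : FiniteDimensional ℝ (TangentSpace (PhaseModel n) x) :=
    inferInstanceAs (FiniteDimensional ℝ (PhaseSpace n))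
  have h0 : ∀ a w v : TangentSpace (PhaseModel n) x,
      Function.update ![a, w] 0 v = ![v, w] := by
    intro a w v; ext i; fin_cases i <;> rfl
  have h1 : ∀ a w v : TangentSpace (PhaseModel n) x,
      Function.update ![a, w] 1 v = ![a, v] := by
    intro a w v; ext i; fin_cases i <;> rfl
  let B : TangentSpace (PhaseModel n) x →ₗ[ℝ] TangentSpace (PhaseModel n) x →ₗ[ℝ] ℝ :=
    LinearMap.mk₂ ℝ (fun v w => Ω.toForm x ![v, w])
      (fun a b w => by
        have h := (Ω.toForm x).map_update_add ![a, w] 0 a b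
        rwa [h0, h0, h0] at h)
      (fun c a w => by
        have h := (Ω.toForm x).map_update_smul ![a, w] 0 c a
        rwa [h0, h0] at h)
      (fun v a b => by
        have h := (Ω.toForm x).map_update_add ![v, a] 1 a b
        rwa [h1, h1, h1] at h)
      (fun c v a => by
        have h := (Ω.toForm x).map_update_smul ![v, a] 1 c a
        rwa [h1, h1] at h)
  have hinj : Function.Injective B := by
    rw [injective_iff_map_eq_zero]
    intro v hv
    exact Ω.nondegenerate x v fun w => by simpa [B] using LinearMap.congr_fun hv w
  have hdim : Module.finrank ℝ (TangentSpace (PhaseModel n) x) =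
      Module.finrank ℝ (TangentSpace (PhaseModel n) x →ₗ[ℝ] ℝ) :=
    (Subspace.dual_finrank_eq (K := ℝ) (V := TangentSpace (PhaseModel n) x)).symm
  obtain ⟨v, hv⟩ := (LinearMap.injective_iff_surjective_of_finrank_eq_finrank hdim).1 hinj
    (l : TangentSpace (PhaseModel n) x →ₗ[ℝ] ℝ)
  exact ⟨v, fun w => by simpa [B] using LinearMap.congr_fun hv w⟩

/-- The Hamiltonian vector field `v(z)` of a function `z`: the vector field with
`Ω(v(z), ·) = dz`, that is `v(z)^k = (Ω⁻¹)^{jk} ∂_j z` in local coordinates. -/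
def hamiltonianVectorField (z : M → ℝ) (x : M) : TangentSpace (PhaseModel n) x :=
  (Ω.exists_hamiltonian_vector x (mfderiv (PhaseModel n) 𝓘(ℝ, ℝ) z x)).choose

/-- The matrix `(Ω_{jk})` of `Ω` in the coordinates of the preferred chart at `p`. -/
def coordMatrix (p : M) (u : PhaseSpace n) : Matrix (Fin (2 * n)) (Fin (2 * n)) ℝ :=
  Matrix.of fun j k => formInChart Ω.toForm p u
    ![EuclideanSpace.single j 1, EuclideanSpace.single k 1]

/-- The measure on `M` given by the volume form `Ωⁿ = Ω ∧ ⋯ ∧ Ω`. In coordinates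
`Ωⁿ = n! Pf(Ω_{jk}) dx¹ ∧ ⋯ ∧ dx²ⁿ` and `|Pf| = √|det|`. It is the least measure that dominates
the resulting coordinate measure of every chart domain; on each chart domain it restricts to that
coordinate measure. -/
def liouvilleMeasure [MeasurableSpace M] : Measure M :=
  ⨆ p : M, Measure.map (extChartAt (PhaseModel n) p).symm
    (((volume : Measure (PhaseSpace n)).withDensity fun u =>
        ENNReal.ofReal (n.factorial * √|(Ω.coordMatrix p u).det|)).restrict
      (extChartAt (PhaseModel n) p).target)

/-- `φ` is the (complete) flow of the Hamiltonian vector field of `H`; the trajectory of `x` is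
`x(t) = φ t x`. -/
structure IsHamiltonianFlow (H : M → ℝ) (φ : ℝ → M → M) : Prop where
  smooth : ContMDiff (𝓘(ℝ, ℝ).prod (PhaseModel n)) (PhaseModel n) ∞ fun q : ℝ × M => φ q.1 q.2
  start : ∀ x, φ 0 x = x
  integralCurve : ∀ x, IsMIntegralCurve (I := PhaseModel n) (fun t => φ t x)
    (Ω.hamiltonianVectorField H)

end SymplecticForm

end Symplectic

section Hybrid

variable {n N : ℕ} {M : Type*} [TopologicalSpace M] [ChartedSpace (PhaseSpace n) M]
  {A : M → Type*} [∀ x, Ring (A x)] [∀ x, Algebra ℂ (A x)] [∀ x, StarRing (A x)]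
  [∀ x, TopologicalSpace (A x)] [TopologicalSpace (TotalSpace (EndC N) A)]
  [FiberBundle (EndC N) A]

variable (N A) in
/-- The bundle `A` of algebras is locally trivial as a bundle of `*`-algebras: its local
trivializations are fiberwise isomorphisms of complex `*`-algebras onto `End(ℂ^N)`. -/
structure IsStarAlgebraBundle : Prop where
  map_mul : ∀ (e : Trivialization (EndC N) (π (EndC N) A)) [MemTrivializationAtlas e],
    ∀ x ∈ e.baseSet, ∀ a b : A x, (e ⟨x, a * b⟩).2 = (e ⟨x, a⟩).2 * (e ⟨x, b⟩).2
  map_star : ∀ (e : Trivialization (EndC N) (π (EndC N) A)) [MemTrivializationAtlas e],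
    ∀ x ∈ e.baseSet, ∀ a : A x, (e ⟨x, star a⟩).2 = star (e ⟨x, a⟩).2
  map_smul : ∀ (e : Trivialization (EndC N) (π (EndC N) A)) [MemTrivializationAtlas e],
    ∀ x ∈ e.baseSet, ∀ (c : ℂ) (a : A x), (e ⟨x, c • a⟩).2 = c • (e ⟨x, a⟩).2

/-- The algebra `A = Γ(M, E)` of smooth sections of the bundle of observables, with fiberwise
operations. -/
abbrev Observables (n N : ℕ) {M : Type*} [TopologicalSpace M] [ChartedSpace (PhaseSpace n) M]
    (A : M → Type*) [∀ x, Ring (A x)] [∀ x, Algebra ℂ (A x)]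
    [∀ x, TopologicalSpace (A x)] [TopologicalSpace (TotalSpace (EndC N) A)]
    [FiberBundle (EndC N) A] : Type _ :=
  ContMDiffSection (PhaseModel n) (EndC N) ∞ A

variable [∀ x, IsTopologicalAddGroup (A x)] [∀ x, ContinuousSMul ℝ (A x)]

/-- The connection is compatible with the `*`-algebra structure of the fibers:
`∇(ab) = (∇a) b + a ∇b` and `∇(a^*) = (∇a)^*`. -/
structure IsStarConnection (cov : CovariantDerivative (PhaseModel n) (EndC N) A) : Prop where
  map_mul : ∀ (a b : ∀ x, A x) (x : M) (v : TangentSpace (PhaseModel n) x),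
    MDifferentiableAt (PhaseModel n) ((PhaseModel n).prod 𝓘(ℝ, EndC N))
      (fun y => TotalSpace.mk' (EndC N) y (a y)) x →
    MDifferentiableAt (PhaseModel n) ((PhaseModel n).prod 𝓘(ℝ, EndC N))
      (fun y => TotalSpace.mk' (EndC N) y (b y)) x →
    cov (fun y => a y * b y) x v = cov a x v * b x + a x * cov b x v
  map_star : ∀ (a : ∀ x, A x) (x : M) (v : TangentSpace (PhaseModel n) x),
    MDifferentiableAt (PhaseModel n) ((PhaseModel n).prod 𝓘(ℝ, EndC N))
      (fun y => TotalSpace.mk' (EndC N) y (a y)) x →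
    cov (fun y => star (a y)) x v = star (cov a x v)

/-- The action `{z, s} = ι_{v(z)} d_α s` of functions on sections. -/
def hybridBracket (Ω : SymplecticForm n M) (cov : CovariantDerivative (PhaseModel n) (EndC N) A)
    (z : M → ℝ) (s : ∀ x, A x) (x : M) : A x :=
  cov s x (Ω.hamiltonianVectorField z x)

/-- A family of sections depends smoothly on time and on the base point. -/
def IsSmoothFamily (a : ℝ → Observables n N A) : Prop :=
  ContMDiff (𝓘(ℝ, ℝ).prod (PhaseModel n)) ((PhaseModel n).prod 𝓘(ℝ, EndC N)) ∞
    fun q : ℝ × M => TotalSpace.mk' (EndC N) q.2 (a q.1 q.2)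

/-- The time evolution of observables: `s(t) = Φ t s` is the solution of
`∂_t s(t) = {H⁰, s(t)} + i [H¹, s(t)]`, `s(0) = s`. -/
structure IsTimeEvolution (Ω : SymplecticForm n M)
    (cov : CovariantDerivative (PhaseModel n) (EndC N) A) (H₀ : M → ℝ) (H₁ : Observables n N A)
    (Φ : ℝ → Observables n N A → Observables n N A) : Prop where
  smooth : ∀ s, IsSmoothFamily fun t => Φ t s
  start : ∀ s, Φ 0 s = s
  equation : ∀ s t x, HasDerivAt (fun τ => Φ τ s x)
    (hybridBracket Ω cov H₀ (Φ t s) x +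
      Complex.I • (H₁ x * Φ t s x - Φ t s x * H₁ x)) t

/-- `U` solves `∂_t U(t) = {H⁰, U(t)} + i H¹ U(t)`, `U(0) = 1`. -/
structure IsEvolutionOperator (Ω : SymplecticForm n M)
    (cov : CovariantDerivative (PhaseModel n) (EndC N) A) (H₀ : M → ℝ) (H₁ : Observables n N A)
    (U : ℝ → Observables n N A) : Prop where
  smooth : IsSmoothFamily U
  start : ∀ x, U 0 x = 1
  equation : ∀ t x, HasDerivAt (fun τ => U τ x)
    (hybridBracket Ω cov H₀ (U t) x + Complex.I • (H₁ x * U t x)) t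

/-- `σ` is a parallel section along the curve `γ`: in the local trivialization at `γ t`, with
`m` the coordinate of `σ`, one has `dm/dt = -α(γ'(t)) m`, where the connection form `α` is read
off from the covariant derivative of the locally constant section with value `m`. -/
def IsParallelAlong (cov : CovariantDerivative (PhaseModel n) (EndC N) A) (γ : ℝ → M)
    (σ : ∀ t, A (γ t)) : Prop :=
  ∀ t, MDifferentiableAt 𝓘(ℝ, ℝ) (PhaseModel n) γ t ∧
    HasDerivAt (fun τ => (trivializationAt (EndC N) A (γ t) ⟨γ τ, σ τ⟩).2)
      (-(trivializationAt (EndC N) A (γ t)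
        ⟨γ t, cov (fun z => (trivializationAt (EndC N) A (γ t)).symm z
            (trivializationAt (EndC N) A (γ t) ⟨γ t, σ t⟩).2)
          (γ t) (mfderiv 𝓘(ℝ, ℝ) (PhaseModel n) γ t (1 : ℝ))⟩).2) t

open Classical in
/-- Parallel transport `A (γ a) → A (γ b)` along `γ` in the bundle of algebras. It is the map
`u ↦ h u h⁻¹` where `h` is the parallel transport operator from `γ a` to `γ b`. -/
def parallelTransport (cov : CovariantDerivative (PhaseModel n) (EndC N) A) (γ : ℝ → M)
    (a b : ℝ) (u : A (γ a)) : A (γ b) :=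
  if hσ : ∃ σ : ∀ t, A (γ t), IsParallelAlong cov γ σ ∧ σ a = u then hσ.choose b else 0

/-- The trace of `a ∈ A x ≅ End(ℂ^N)`. -/
def fiberTrace (N : ℕ) {M : Type*} [TopologicalSpace M] {A : M → Type*}
    [∀ x, TopologicalSpace (A x)] [TopologicalSpace (TotalSpace (EndC N) A)]
    [FiberBundle (EndC N) A] (x : M) (a : A x) : ℂ :=
  LinearMap.trace ℂ (EuclideanSpace ℂ (Fin N))
    (trivializationAt (EndC N) A x ⟨x, a⟩).2.toLinearMap

variable [MeasurableSpace M]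

/-- `E_ρ(s)` is defined. -/
def HasExpectation (Ω : SymplecticForm n M) (ρ s : Observables n N A) : Prop :=
  Integrable (fun x => fiberTrace N x (s x * ρ x)) Ω.liouvilleMeasure

/-- The expectation value `E_ρ(s) = ∫ Tr(s_x ρ_x) Ωⁿ`. -/
def expectation (Ω : SymplecticForm n M) (ρ s : Observables n N A) : ℂ :=
  ∫ x, fiberTrace N x (s x * ρ x) ∂Ω.liouvilleMeasure

/-- A (smooth) hybrid density matrix: fiberwise Hermitian with nonnegative eigenvalues, and
normalized by `∫ Tr(ρ_x) Ωⁿ = 1`. -/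
structure IsHybridState (Ω : SymplecticForm n M) (ρ : Observables n N A) : Prop where
  selfAdjoint : ∀ x, star (ρ x) = ρ x
  nonneg : ∀ x, ∀ c ∈ spectrum ℂ (ρ x), 0 ≤ c.re
  normalized : ∫ x, fiberTrace N x (ρ x) ∂Ω.liouvilleMeasure = 1

/-- `r` is the evolution of `ρ` that is dual to the evolution `Φ` of observables:
`E_{r(t)}(s) = E_ρ(s(t))` for every observable `s` for which the right-hand side is defined. -/
def IsDualEvolution (Ω : SymplecticForm n M) (Φ : ℝ → Observables n N A → Observables n N A)
    (ρ : Observables n N A) (r : ℝ → Observables n N A) : Prop :=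
  ∀ t s, HasExpectation Ω ρ (Φ t s) →
    HasExpectation Ω (r t) s ∧ expectation Ω (r t) s = expectation Ω ρ (Φ t s)

end Hybrid

end

/-! The dual evolution is ρ(t) = Φ(-t)ρ, the evolution of observables run backwards, and its
algebraic properties are read off along single trajectories. Along τ ↦ φ_τ(x), the section τ ↦ Φ(c -
τ)s has covariant derivative -i[H₁, ·]: the term {H₀, s} produced by moving along the trajectory
cancels the one produced by reversing time (`IsTimeEvolution.isHeisenbergAlong`). Solutions of this
Heisenberg equation are closed under differences, products and adjoints. Their trace is constant,
because the trace kills commutators and also kills the connection form, which is a derivation of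
End(ℂ^N). In particular Tr(b*b) is constant, so a solution that vanishes once vanishes always; this
conservation law is the only ODE uniqueness used in the fibers.

The trace of the product of Φ(t - τ)s and Φ(-τ)ρ, compared at τ = t and τ = 0, turns Tr(s ρ(t)) at
φ_t(x) into Tr(s(t) ρ) at x. Integration gives duality once the flow preserves the Liouville
measure. For this, the pullback of Ω to time × chart is closed and its contraction with ∂_t is
exact, so its spatial components do not depend on time (`fderiv_apply_eq_zero_of_extDeriv_eq_zero`).
A symplectic map then matches the chart densities by change of variables.

Uniqueness (`eq_of_expectation_eq`): testing against a cutoff of the adjoint of the difference gives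
a vanishing integral of a continuous nonnegative function. Hermiticity and spectrum propagate
because the Heisenberg equation respects adjoints and products. Finally U satisfies ∇u = -iH₁u along
trajectories, hence is unitary, and conjugating a Heisenberg solution by it removes the commutator
and leaves a parallel section. -/

noncomputable section
set_option maxSynthPendingDepth 3
open scoped ComplexOrder Topology
set_option linter.unusedSectionVars false

/-! ### Traces and derivations on End(ℂ^N) -/

section EndC
variable {N : ℕ}

/-- The trace on `End(ℂ^N)`. -/
def endTrace (N : ℕ) : EndC N →ₗ[ℂ] ℂ :=
  LinearMap.trace ℂ (EuclideanSpace ℂ (Fin N)) ∘ₗ ContinuousLinearMap.coeLM ℂ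

theorem endTrace_mul_comm (a b : EndC N) : endTrace N (a * b) = endTrace N (b * a) :=
  LinearMap.trace_mul_comm ℂ a.toLinearMap b.toLinearMap

/-- The algebra isomorphism of `End(ℂ^N)` with matrices. -/
def endToMatrix (N : ℕ) : EndC N ≃⋆ₐ[ℂ] Matrix (Fin N) (Fin N) ℂ :=
  (Matrix.toEuclideanCLM (n := Fin N) (𝕜 := ℂ)).symm

theorem endTrace_eq_matrix (a : EndC N) : endTrace N a = (endToMatrix N a).trace := by
  rw [endTrace, LinearMap.comp_apply,
    LinearMap.trace_eq_matrix_trace ℂ (EuclideanSpace.basisFun (Fin N) ℂ).toBasis]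
  rfl

theorem endTrace_star_mul_self_eq_zero {a : EndC N} (h : endTrace N (star a * a) = 0) : a = 0 := by
  rw [endTrace_eq_matrix, map_mul, map_star, Matrix.star_eq_conjTranspose,
    Matrix.trace_conjTranspose_mul_self_eq_zero_iff] at h
  simpa using h

theorem endTrace_star_mul_self_nonneg (a : EndC N) :
    0 ≤ (endTrace N (star a * a)).re ∧ (endTrace N (star a * a)).im = 0 := by
  have h : 0 ≤ endTrace N (star a * a) := by
    rw [endTrace_eq_matrix, map_mul, map_star, Matrix.star_eq_conjTranspose]
    exact (Matrix.posSemidef_conjTranspose_mul_self _).trace_nonneg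
  exact ⟨(Complex.le_def.1 h).1, (Complex.le_def.1 h).2.symm⟩

/-- A tracial additive functional on matrices is determined by its value on scalars. -/
theorem matrix_tracial_eq (τ : Matrix (Fin N) (Fin N) ℂ →+ ℂ)
    (h : ∀ a b, τ (a * b) = τ (b * a)) (i : Fin N) (a : Matrix (Fin N) (Fin N) ℂ) :
    τ a = τ (Matrix.single i i a.trace) := by
  -- Matrix units: E_ji E_ij = E_jj while E_ij E_ji = E_ii; below, E_jj E_jk = E_jk while E_jk E_jj
  -- = 0 for j ≠ k.
  have hd : ∀ j (c : ℂ), τ (Matrix.single j j c) = τ (Matrix.single i i c) := fun j c => by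
    have := h (Matrix.single j i c) (Matrix.single i j 1)
    simpa using this
  have ho : ∀ j k (c : ℂ), j ≠ k → τ (Matrix.single j k c) = 0 := fun j k c hjk => by
    have := h (Matrix.single j j c) (Matrix.single j k 1)
    simpa [Matrix.single_mul_single_of_ne _ _ _ _ hjk.symm] using this
  conv_lhs => rw [Matrix.matrix_eq_sum_single a]
  rw [map_sum, Matrix.trace]
  have : Matrix.single i i (∑ j, a.diag j) = ∑ j, Matrix.single i i (a j j) := by
    exact map_sum (Matrix.singleAddMonoidHom (α := ℂ) i i) (fun j => a j j) Finset.univ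
  rw [this, map_sum]
  refine Finset.sum_congr rfl fun j _ => ?_
  rw [map_sum, Finset.sum_eq_single j]
  · exact hd j _
  · exact fun k _ hk => ho j k _ hk.symm
  · simp

/-- A matrix and the scalar matrix tr(a)/N have equal trace, so τ agrees on them. Only additivity is
assumed because a connection is merely real linear; hence vanishing on all complex scalars is a
separate hypothesis. -/
theorem matrix_tracial_eq_zero (τ : Matrix (Fin N) (Fin N) ℂ →+ ℂ)
    (h : ∀ a b, τ (a * b) = τ (b * a)) (h1 : ∀ c : ℂ, τ (Matrix.scalar (Fin N) c) = 0) 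
    (a : Matrix (Fin N) (Fin N) ℂ) : τ a = 0 := by
  rcases isEmpty_or_nonempty (Fin N) with h0 | ⟨⟨i⟩⟩
  · rw [Subsingleton.elim a 0, map_zero]
  · have hN : (N : ℂ) ≠ 0 := by
      have := i.pos
      exact_mod_cast this.ne'
    have hs := h1 (a.trace / N)
    rw [matrix_tracial_eq τ h i] at hs
    rw [matrix_tracial_eq τ h i, ← hs]
    congr 2
    simp [Matrix.trace]
    simp [mul_div_cancel₀, hN]

theorem end_tracial_eq_zero (τ : EndC N →+ ℂ)
    (h : ∀ a b, τ (a * b) = τ (b * a)) (h1 : ∀ c : ℂ, τ (c • 1) = 0) (a : EndC N) : τ a = 0 := by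
  let e := (endToMatrix N).symm
  have := matrix_tracial_eq_zero
    (⟨⟨fun m => τ (e m), by rw [map_zero, map_zero]⟩, fun m m' => by
      change τ (e (m + m')) = τ (e m) + τ (e m')
      rw [map_add, map_add]⟩ : Matrix (Fin N) (Fin N) ℂ →+ ℂ)
    (fun a b => by
      change τ (e (a * b)) = τ (e (b * a))
      rw [map_mul e, map_mul e, h])
    (fun c => by
      change τ (e (Matrix.scalar (Fin N) c)) = 0
      rw [Matrix.scalar_apply, ← Matrix.smul_one_eq_diagonal, map_smul, map_one, h1])
    (endToMatrix N a)
  change τ (e (endToMatrix N a)) = 0 at this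
  rwa [StarAlgEquiv.symm_apply_apply] at this

/-- The trace is invariant under complex algebra homomorphisms. -/
theorem endTrace_algHom (f : EndC N → EndC N) (hadd : ∀ a b, f (a + b) = f a + f b)
    (hmul : ∀ a b, f (a * b) = f a * f b) (hone : f 1 = 1) (hsmul : ∀ (c : ℂ) a, f (c • a) = c • f a)
    (a : EndC N) : endTrace N (f a) = endTrace N a := by
  have h0 : f 0 = 0 := by simpa using hsmul 0 0
  have := end_tracial_eq_zero
    (⟨⟨fun a => endTrace N (f a) - endTrace N a, by simp [h0]⟩, fun a b => by
      simp only [hadd, map_add]; ring⟩ : EndC N →+ ℂ)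
    (fun a b => by
      change endTrace N (f (a * b)) - endTrace N (a * b) = endTrace N (f (b * a)) - endTrace N (b * a)
      rw [hmul, hmul, endTrace_mul_comm (f a), endTrace_mul_comm a])
    (fun c => by
      change endTrace N (f (c • 1)) - endTrace N (c • 1) = 0
      rw [hsmul, hone, sub_self]) a
  exact sub_eq_zero.1 this

/-- Additive derivations of `End(ℂ^N)` that vanish on real scalars vanish on complex scalars. -/
theorem derivation_smul_one (D : EndC N → EndC N) (hadd : ∀ a b, D (a + b) = D a + D b)
    (hmul : ∀ a b, D (a * b) = D a * b + a * D b) (hone : ∀ r : ℝ, D (r • 1) = 0) (c : ℂ) :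
    D (c • 1) = 0 := by
  have hneg : D (-1) = 0 := by simpa using hone (-1)
  have hJ : D (Complex.I • 1) = 0 := by
    -- J is central with J² = -1, so 0 = D(J²) = 2 J D(J), and J is invertible.
    set J : EndC N := Complex.I • 1 with hJdef
    have hJJ : J * J = -1 := by
      simp [J, smul_smul, Complex.I_mul_I]
    have hcomm : ∀ b, J * b = b * J := fun b => by simp [J]
    have hJJ' : D J * J + J * D J = 0 := by rw [← hmul, hJJ, hneg]
    have h2 : (2 : ℂ) • (J * D J) = 0 := by
      rw [two_smul]
      nth_rw 1 [hcomm]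
      exact hJJ'
    have h3 : J * D J = 0 := (smul_eq_zero.1 h2).resolve_left two_ne_zero
    have h4 : J * (J * D J) = 0 := by rw [h3, mul_zero]
    rw [← mul_assoc, hJJ] at h4
    simpa using h4
  have hc : c • (1 : EndC N) = (c.re • (1 : EndC N)) + (c.im • (1 : EndC N)) * (Complex.I • 1) := by
    conv_lhs => rw [← Complex.re_add_im c]
    rw [add_smul, mul_smul, smul_one_mul, Complex.coe_smul, Complex.coe_smul]
  rw [hc, hadd, hmul, hone, hone, hJ]
  simp

/-- The trace vanishes on the image of any additive derivation. -/
theorem endTrace_derivation (D : EndC N → EndC N) (hadd : ∀ a b, D (a + b) = D a + D b)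
    (hmul : ∀ a b, D (a * b) = D a * b + a * D b) (hone : ∀ r : ℝ, D (r • 1) = 0) (a : EndC N) :
    endTrace N (D a) = 0 := by
  have h0 : D 0 = 0 := by simpa using hone 0
  exact end_tracial_eq_zero
    (⟨⟨fun a => endTrace N (D a), by simp [h0]⟩, fun a b => by simp [hadd]⟩ : EndC N →+ ℂ)
    (fun a b => by
      change endTrace N (D (a * b)) = endTrace N (D (b * a))
      rw [hmul, hmul, map_add, map_add, endTrace_mul_comm (D a), endTrace_mul_comm a, add_comm])
    (fun c => by
      change endTrace N (D (c • 1)) = 0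
      rw [derivation_smul_one D hadd hmul hone, map_zero]) a

end EndC

/-! ### Fiber coordinates and the fiber trace -/

section FiberAlgebra

variable {N : ℕ} {M : Type*} [TopologicalSpace M]
  {A : M → Type*} [∀ x, Ring (A x)] [∀ x, Algebra ℂ (A x)] [∀ x, StarRing (A x)]
  [∀ x, TopologicalSpace (A x)] [TopologicalSpace (TotalSpace (EndC N) A)]
  [FiberBundle (EndC N) A]

variable (N A) in
/-- The coordinate in `End(ℂ^N)` of `a ∈ A z` in the preferred trivialization at `p`. -/
def coordAt (p : M) (z : M) (a : A z) : EndC N := (trivializationAt (EndC N) A p ⟨z, a⟩).2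

variable (N A) in
/-- The section that is constant equal to `m` in the preferred trivialization at `p`. -/
def localConst (p : M) (m : EndC N) (z : M) : A z := (trivializationAt (EndC N) A p).symm z m

variable (N A) in
/-- The domain of the preferred trivialization at `p`. -/
abbrev frameNhd (p : M) : Set M := (trivializationAt (EndC N) A p).baseSet

theorem coordAt_localConst {p z : M} (hz : z ∈ frameNhd N A p) (m : EndC N) :
    coordAt N A p z (localConst N A p m z) = m := by
  simp only [coordAt, localConst, Trivialization.apply_mk_symm _ hz]

theorem localConst_coordAt {p z : M} (hz : z ∈ frameNhd N A p) (a : A z) :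
    localConst N A p (coordAt N A p z a) z = a :=
  Trivialization.symm_apply_apply_mk _ hz a

theorem coordAt_injective {p z : M} (hz : z ∈ frameNhd N A p) : Function.Injective (coordAt N A p z) :=
  Function.LeftInverse.injective (localConst_coordAt hz)

theorem mem_frameNhd (p : M) : p ∈ frameNhd N A p := FiberBundle.mem_baseSet_trivializationAt' p

section Algebra
variable (hA : IsStarAlgebraBundle N A) {p z : M} (hz : z ∈ frameNhd N A p)
include hA hz

theorem coordAt_mul (a b : A z) : coordAt N A p z (a * b) = coordAt N A p z a * coordAt N A p z b :=
  hA.map_mul _ z hz a b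

theorem coordAt_star (a : A z) : coordAt N A p z (star a) = star (coordAt N A p z a) :=
  hA.map_star _ z hz a

theorem coordAt_smul (c : ℂ) (a : A z) : coordAt N A p z (c • a) = c • coordAt N A p z a :=
  hA.map_smul _ z hz c a

/-- Preservation of 1 is not part of `IsStarAlgebraBundle`; it follows from multiplicativity and
surjectivity. -/
theorem coordAt_one : coordAt N A p z 1 = 1 := by
  have := coordAt_mul hA hz 1 (localConst N A p 1 z)
  rw [one_mul, coordAt_localConst hz, mul_one] at this
  exact this.symm

end Algebra

section Linear
variable [VectorBundle ℝ (EndC N) A] {p z : M} (hz : z ∈ frameNhd N A p)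
include hz

theorem coordAt_add (a b : A z) : coordAt N A p z (a + b) = coordAt N A p z a + coordAt N A p z b :=
  ((trivializationAt (EndC N) A p).linear ℝ hz).map_add a b

theorem coordAt_real_smul (c : ℝ) (a : A z) : coordAt N A p z (c • a) = c • coordAt N A p z a :=
  ((trivializationAt (EndC N) A p).linear ℝ hz).map_smul c a

theorem coordAt_zero : coordAt N A p z 0 = 0 := by
  have := coordAt_add hz (0 : A z) 0
  rwa [add_zero, left_eq_add] at this

theorem coordAt_neg (a : A z) : coordAt N A p z (-a) = -coordAt N A p z a := by
  have := coordAt_add hz a (-a)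
  rw [add_neg_cancel, coordAt_zero hz] at this
  exact (neg_eq_of_add_eq_zero_right this.symm).symm

theorem coordAt_sub (a b : A z) : coordAt N A p z (a - b) = coordAt N A p z a - coordAt N A p z b := by
  rw [sub_eq_add_neg, coordAt_add hz, coordAt_neg hz, sub_eq_add_neg]

end Linear

variable [VectorBundle ℝ (EndC N) A] (hA : IsStarAlgebraBundle N A)
include hA

/-- The fiber trace may be computed in any preferred trivialization. -/
theorem fiberTrace_eq {p z : M} (hz : z ∈ frameNhd N A p) (a : A z) :
    fiberTrace N z a = endTrace N (coordAt N A p z a) := by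
  have hzz := mem_frameNhd (N := N) (A := A) z
  have hc : ∀ m, coordAt N A z z (localConst N A z m z) = m := coordAt_localConst hzz
  -- The transition map between the two trivializations is a complex algebra homomorphism of
  -- End(ℂ^N), so it preserves the trace.
  have key := endTrace_algHom (fun m => coordAt N A p z (localConst N A z m z))
    (fun m m' => by
      rw [← coordAt_add hz]; congr 1; apply coordAt_injective hzz; rw [coordAt_add hzz]; simp only [hc])
    (fun m m' => by
      rw [← coordAt_mul hA hz]; congr 1; apply coordAt_injective hzz
      rw [coordAt_mul hA hzz]; simp only [hc])
    (by
      have h1 : localConst N A z 1 z = 1 :=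
        coordAt_injective hzz (by rw [coordAt_one hA hzz]; exact hc 1)
      simp only [h1, coordAt_one hA hz])
    (fun c m => by
      rw [← coordAt_smul hA hz]; congr 1; apply coordAt_injective hzz
      rw [coordAt_smul hA hzz]; simp only [hc])
    (coordAt N A z z a)
  rw [localConst_coordAt hzz] at key
  exact key.symm

theorem fiberTrace_mul_comm (z : M) (a b : A z) : fiberTrace N z (a * b) = fiberTrace N z (b * a) := by
  have hz := mem_frameNhd (N := N) (A := A) z
  rw [fiberTrace_eq hA hz, fiberTrace_eq hA hz, coordAt_mul hA hz, coordAt_mul hA hz,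
    endTrace_mul_comm]

theorem eq_zero_of_fiberTrace_star_mul_self {z : M} {a : A z}
    (h : fiberTrace N z (star a * a) = 0) : a = 0 := by
  have hz := mem_frameNhd (N := N) (A := A) z
  rw [fiberTrace_eq hA hz, coordAt_mul hA hz, coordAt_star hA hz] at h
  exact coordAt_injective hz ((endTrace_star_mul_self_eq_zero h).trans (coordAt_zero hz).symm)

end FiberAlgebra

/-! ### Derivatives in fibers and along curves -/

section TVSDeriv

/-- Continuous linear maps between topological vector spaces preserve derivatives. -/
theorem HasDerivAt.clm_comp_tvs {F G : Type*} [AddCommGroup F] [Module ℝ F] [TopologicalSpace F]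
    [ContinuousSMul ℝ F] [AddCommGroup G] [Module ℝ G] [TopologicalSpace G] [ContinuousSMul ℝ G]
    (L : F →L[ℝ] G) {f : ℝ → F} {f' : F} {t : ℝ} (hf : HasDerivAt f f' t) :
    HasDerivAt (fun τ => L (f τ)) (L f') t := by
  have h1 := hf.isLittleOTVS
  refine ⟨?_⟩
  refine ((L.isBigOTVS_fun_comp).trans_isLittleOTVS h1).congr_left fun p => ?_
  simp

/-- The chain rule along a curve in the product of the time axis and a manifold. -/
theorem hasDerivAt_along_curve {E G M : Type*} [NormedAddCommGroup E] [NormedSpace ℝ E]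
    [NormedAddCommGroup G] [NormedSpace ℝ G] [TopologicalSpace M] [ChartedSpace E M]
    {f : ℝ × M → G} {γ : ℝ → M} {s : ℝ → ℝ} {s' t : ℝ} {f' : G}
    (hf : MDifferentiableAt (𝓘(ℝ, ℝ).prod 𝓘(ℝ, E)) 𝓘(ℝ, G) f (s t, γ t))
    (hs : HasDerivAt s s' t) (hγ : MDifferentiableAt 𝓘(ℝ, ℝ) 𝓘(ℝ, E) γ t)
    (hf' : HasDerivAt (fun τ => f (τ, γ t)) f' (s t)) :
    HasDerivAt (fun τ => f (s τ, γ τ))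
      (s' • f' + mvfderiv 𝓘(ℝ, E) (fun z => f (s t, z)) (γ t)
        (mfderiv 𝓘(ℝ, ℝ) 𝓘(ℝ, E) γ t (1 : ℝ))) t := by
  have hsm : HasMFDerivAt 𝓘(ℝ, ℝ) 𝓘(ℝ, ℝ) s t (ContinuousLinearMap.toSpanSingleton ℝ s') :=
    hasMFDerivAt_iff_hasFDerivAt.2 hs.hasFDerivAt
  have hk := HasMFDerivAt.prodMk hsm hγ.hasMFDerivAt
  have hfk := HasMFDerivAt.comp t hf.hasMFDerivAt hk
  have hi : HasMFDerivAt 𝓘(ℝ, ℝ) (𝓘(ℝ, ℝ).prod 𝓘(ℝ, E)) (fun τ : ℝ => (τ, γ t)) (s t) _ :=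
    HasMFDerivAt.prodMk (hasMFDerivAt_id _) (hasMFDerivAt_const _ _)
  have hfi := HasMFDerivAt.comp (s t) hf.hasMFDerivAt hi
  have hj : HasMFDerivAt 𝓘(ℝ, E) (𝓘(ℝ, ℝ).prod 𝓘(ℝ, E)) (fun z : M => (s t, z)) (γ t) _ :=
    HasMFDerivAt.prodMk (hasMFDerivAt_const _ _) (hasMFDerivAt_id _)
  have hfj := HasMFDerivAt.comp (γ t) hf.hasMFDerivAt hj
  let L : ℝ × E →L[ℝ] G := mfderiv (𝓘(ℝ, ℝ).prod 𝓘(ℝ, E)) 𝓘(ℝ, G) f (s t, γ t)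
  let w : E := mfderiv 𝓘(ℝ, ℝ) 𝓘(ℝ, E) γ t (1 : ℝ)
  have hfi' : HasFDerivAt (fun τ => f (τ, γ t))
      (L.comp ((ContinuousLinearMap.id ℝ ℝ).prod 0)) (s t) := hasMFDerivAt_iff_hasFDerivAt.1 hfi
  have hfk' : HasFDerivAt (fun τ => f (s τ, γ τ))
      (L.comp ((ContinuousLinearMap.toSpanSingleton ℝ s').prod
        (mfderiv 𝓘(ℝ, ℝ) 𝓘(ℝ, E) γ t : ℝ →L[ℝ] E))) t := hasMFDerivAt_iff_hasFDerivAt.1 hfk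
  have e1 : L (1, 0) = f' := hfi'.hasDerivAt.unique hf'
  have e2 : mvfderiv 𝓘(ℝ, E) (fun z => f (s t, z)) (γ t) w = L (0, w) := by
    simp only [mvfderiv]
    exact congrArg (fun T : E →L[ℝ] G => T w) hfj.mfderiv
  have e3 : (s', w) = s' • ((1, 0) : ℝ × E) + (0, w) := by simp
  have h := hfk'.hasDerivAt
  have e4 : (L.comp ((ContinuousLinearMap.toSpanSingleton ℝ s').prod
        (mfderiv 𝓘(ℝ, ℝ) 𝓘(ℝ, E) γ t : ℝ →L[ℝ] E))) 1 = L (s', w) := by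
    change L (((ContinuousLinearMap.toSpanSingleton ℝ s') 1), w) = _
    rw [ContinuousLinearMap.toSpanSingleton_apply, one_smul]
  rw [e4, e3, map_add, map_smul, e1, ← e2] at h
  exact h

end TVSDeriv

/-! ### The connection form as a *-derivation -/

section Connection

variable {n N : ℕ} {M : Type*} [TopologicalSpace M] [ChartedSpace (PhaseSpace n) M]
  {A : M → Type*} [∀ x, Ring (A x)] [∀ x, Algebra ℂ (A x)] [∀ x, StarRing (A x)]
  [∀ x, TopologicalSpace (A x)] [TopologicalSpace (TotalSpace (EndC N) A)]
  [FiberBundle (EndC N) A] [∀ x, IsTopologicalAddGroup (A x)] [∀ x, ContinuousSMul ℝ (A x)]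
  [VectorBundle ℝ (EndC N) A] [ContMDiffVectorBundle ∞ (EndC N) A (PhaseModel n)]

theorem mdifferentiableAt_iff_coordAt {σ : ∀ x, A x} {x : M} :
    MDifferentiableAt (PhaseModel n) ((PhaseModel n).prod 𝓘(ℝ, EndC N))
      (fun y => TotalSpace.mk' (EndC N) y (σ y)) x ↔
    MDifferentiableAt (PhaseModel n) 𝓘(ℝ, EndC N) (fun y => coordAt N A x y (σ y)) x :=
  mdifferentiableAt_section _ σ

theorem frameNhd_mem_nhds (x : M) : frameNhd N A x ∈ 𝓝 x :=
  (trivializationAt (EndC N) A x).open_baseSet.mem_nhds (mem_frameNhd x)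

theorem coordAt_localConst_eventuallyEq (x : M) (m : EndC N) :
    (fun y => coordAt N A x y (localConst N A x m y)) =ᶠ[𝓝 x] fun _ => m :=
  Filter.eventually_of_mem (frameNhd_mem_nhds x) fun _ hy => coordAt_localConst hy m

theorem mdifferentiableAt_localConst (x : M) (m : EndC N) :
    MDifferentiableAt (PhaseModel n) ((PhaseModel n).prod 𝓘(ℝ, EndC N))
      (fun y => TotalSpace.mk' (EndC N) y (localConst N A x m y)) x :=
  mdifferentiableAt_iff_coordAt.2
    (mdifferentiableAt_const.congr_of_eventuallyEq (coordAt_localConst_eventuallyEq x m))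

variable (cov : CovariantDerivative (PhaseModel n) (EndC N) A)

/-- The connection form of `cov` at `x` in the direction `v`, in the preferred trivialization. -/
def connForm (x : M) (v : TangentSpace (PhaseModel n) x) (m : EndC N) : EndC N :=
  coordAt N A x x (cov (localConst N A x m) x v)

/-- The covariant derivative is the derivative of coordinates plus the connection form. -/
theorem coordAt_cov {σ : ∀ x, A x} {x : M} (v : TangentSpace (PhaseModel n) x)
    (hσ : MDifferentiableAt (PhaseModel n) ((PhaseModel n).prod 𝓘(ℝ, EndC N))
      (fun y => TotalSpace.mk' (EndC N) y (σ y)) x) :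
    coordAt N A x x (cov σ x v) =
      mvfderiv (PhaseModel n) (fun y => coordAt N A x y (σ y)) x v +
        connForm cov x v (coordAt N A x x (σ x)) := by
  have hx := mem_frameNhd (N := N) (A := A) x
  have h1 : ContMDiffVectorBundle 1 (EndC N) A (PhaseModel n) := .of_le (n := ∞) (by simp)
  -- The Leibniz terms of the two derivatives cancel, so F is tensorial and depends only on σ x;
  -- evaluating it on the constant section with that value gives the connection form.
  let F : (∀ x, A x) → EndC N := fun σ => coordAt N A x x (cov σ x v) -
    mvfderiv (PhaseModel n) (fun y => coordAt N A x y (σ y)) x v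
  have hF : TensorialAt (PhaseModel n) (EndC N) F x := by
    refine ⟨fun {f σ} hf hσ => ?_, fun {σ σ'} hσ hσ' => ?_⟩
    · have e : (fun y => coordAt N A x y ((f • σ) y)) =ᶠ[𝓝 x]
          f • fun y => coordAt N A x y (σ y) :=
        Filter.eventually_of_mem (frameNhd_mem_nhds x) fun y hy => coordAt_real_smul hy _ _
      have e' : mvfderiv (PhaseModel n) (fun y => coordAt N A x y ((f • σ) y)) x v =
          mvfderiv (PhaseModel n) (f • fun y => coordAt N A x y (σ y)) x v := by
        simp only [mvfderiv]
        rw [e.mfderiv_eq]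
        rfl
      simp only [F]
      rw [e', cov.isCovariantDerivativeOnUniv.leibniz hσ hf,
        mvfderiv_smul hf (mdifferentiableAt_iff_coordAt.1 hσ)]
      simp only [_root_.add_apply, _root_.smul_apply,
        ContinuousLinearMap.smulRight_apply, coordAt_add hx, coordAt_real_smul hx, smul_sub]
      abel
    · have e : (fun y => coordAt N A x y ((σ + σ') y)) =ᶠ[𝓝 x]
          (fun y => coordAt N A x y (σ y)) + fun y => coordAt N A x y (σ' y) :=
        Filter.eventually_of_mem (frameNhd_mem_nhds x) fun y hy => coordAt_add hy _ _
      have e' : mvfderiv (PhaseModel n) (fun y => coordAt N A x y ((σ + σ') y)) x v =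
          mvfderiv (PhaseModel n) ((fun y => coordAt N A x y (σ y)) +
            fun y => coordAt N A x y (σ' y)) x v := by
        simp only [mvfderiv]
        rw [e.mfderiv_eq]
        rfl
      simp only [F]
      rw [e', cov.isCovariantDerivativeOnUniv.add hσ hσ',
        mvfderiv_add (mdifferentiableAt_iff_coordAt.1 hσ) (mdifferentiableAt_iff_coordAt.1 hσ')]
      simp only [_root_.add_apply, coordAt_add hx]
      abel
  have key := hF.pointwise hσ (mdifferentiableAt_localConst x (coordAt N A x x (σ x)))
    (localConst_coordAt hx (σ x)).symm
  have e0 : mvfderiv (PhaseModel n)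
      (fun y => coordAt N A x y (localConst N A x (coordAt N A x x (σ x)) y)) x v = 0 := by
    simp only [mvfderiv]
    rw [(coordAt_localConst_eventuallyEq x _).mfderiv_eq, mfderiv_const]
    rfl
  simp only [F, e0, sub_zero] at key
  rw [connForm, ← key]
  abel

/-- Sections with constant coordinates have the covariant derivative of the constant section. -/
theorem cov_localConst_eq {x : M} {c : EndC N} {τ : ∀ y, A y}
    (h : ∀ y ∈ frameNhd N A x, coordAt N A x y (τ y) = c) :
    cov (localConst N A x c) x = cov τ x := by
  refine IsCovariantDerivativeOn.congr_of_eqOn cov.isCovariantDerivativeOn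
    (mdifferentiableAt_localConst x c) (mdifferentiableAt_iff_coordAt.2 ?_) (frameNhd_mem_nhds x)
    fun y hy => coordAt_injective hy ((coordAt_localConst hy c).trans (h y hy).symm)
  exact mdifferentiableAt_const.congr_of_eventuallyEq
    (Filter.eventually_of_mem (frameNhd_mem_nhds x) h)

variable {cov}

theorem connForm_add (x : M) (v : TangentSpace (PhaseModel n) x) (a b : EndC N) :
    connForm cov x v (a + b) = connForm cov x v a + connForm cov x v b := by
  have e := cov_localConst_eq cov (x := x) (c := a + b)
    (τ := localConst N A x a + localConst N A x b) fun y hy => by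
      rw [Pi.add_apply, coordAt_add hy, coordAt_localConst hy, coordAt_localConst hy]
  simp only [connForm]
  rw [e, cov.isCovariantDerivativeOnUniv.add (mdifferentiableAt_localConst x a)
    (mdifferentiableAt_localConst x b), _root_.add_apply, coordAt_add (mem_frameNhd x)]

theorem connForm_smul (x : M) (v : TangentSpace (PhaseModel n) x) (r : ℝ) (a : EndC N) :
    connForm cov x v (r • a) = r • connForm cov x v a := by
  have e := cov_localConst_eq cov (x := x) (c := r • a)
    (τ := r • localConst N A x a) fun y hy => by
      rw [Pi.smul_apply, coordAt_real_smul hy, coordAt_localConst hy]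
  simp only [connForm]
  rw [e, cov.isCovariantDerivativeOnUniv.smul_const r (mdifferentiableAt_localConst x a),
    _root_.smul_apply, coordAt_real_smul (mem_frameNhd x)]

variable (hA : IsStarAlgebraBundle N A) (hcov : IsStarConnection cov)
include hA hcov

/-- The product of the constant sections a and b has constant coordinate ab, so the Leibniz rule of
`cov` passes to the connection form. -/
theorem connForm_mul (x : M) (v : TangentSpace (PhaseModel n) x) (a b : EndC N) :
    connForm cov x v (a * b) = connForm cov x v a * b + a * connForm cov x v b := by
  have e := cov_localConst_eq cov (x := x) (c := a * b)
    (τ := fun y => localConst N A x a y * localConst N A x b y) fun y hy => by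
      rw [coordAt_mul hA hy, coordAt_localConst hy, coordAt_localConst hy]
  have hx := mem_frameNhd (N := N) (A := A) x
  simp only [connForm]
  rw [e, hcov.map_mul _ _ x v (mdifferentiableAt_localConst x a)
    (mdifferentiableAt_localConst x b), coordAt_add hx, coordAt_mul hA hx, coordAt_mul hA hx,
    coordAt_localConst hx, coordAt_localConst hx]

theorem connForm_star (x : M) (v : TangentSpace (PhaseModel n) x) (a : EndC N) :
    connForm cov x v (star a) = star (connForm cov x v a) := by
  have e := cov_localConst_eq cov (x := x) (c := star a)
    (τ := fun y => star (localConst N A x a y)) fun y hy => by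
      rw [coordAt_star hA hy, coordAt_localConst hy]
  have hx := mem_frameNhd (N := N) (A := A) x
  simp only [connForm]
  rw [e, hcov.map_star _ x v (mdifferentiableAt_localConst x a), coordAt_star hA hx]

theorem connForm_one (x : M) (v : TangentSpace (PhaseModel n) x) : connForm cov x v 1 = 0 := by
  have h := connForm_mul hA hcov x v 1 1
  rw [mul_one, mul_one, one_mul] at h
  exact left_eq_add.1 h

/-- Only real linearity is given by the connection; the imaginary unit is handled by the derivation
property. -/
theorem connForm_smul_one (x : M) (v : TangentSpace (PhaseModel n) x) (c : ℂ) :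
    connForm cov x v (c • 1) = 0 :=
  derivation_smul_one _ (connForm_add x v) (connForm_mul hA hcov x v)
    (fun r => by rw [connForm_smul, connForm_one hA hcov, smul_zero]) c

theorem endTrace_connForm (x : M) (v : TangentSpace (PhaseModel n) x) (a : EndC N) :
    endTrace N (connForm cov x v a) = 0 :=
  endTrace_derivation _ (connForm_add x v) (connForm_mul hA hcov x v)
    (fun r => by rw [connForm_smul, connForm_one hA hcov, smul_zero]) a

end Connection

/-! ### Covariant derivatives and parallel sections along a curve -/

section AlongCurve

variable {n N : ℕ} {M : Type*} [TopologicalSpace M] [ChartedSpace (PhaseSpace n) M]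
  {A : M → Type*} [∀ x, Ring (A x)] [∀ x, Algebra ℂ (A x)] [∀ x, StarRing (A x)]
  [∀ x, TopologicalSpace (A x)] [TopologicalSpace (TotalSpace (EndC N) A)]
  [FiberBundle (EndC N) A] [∀ x, IsTopologicalAddGroup (A x)] [∀ x, ContinuousSMul ℝ (A x)]

/-- The section `b` along the curve `γ` has covariant derivative `b'` at time `t`. -/
def HasCovDerivAt (cov : CovariantDerivative (PhaseModel n) (EndC N) A) (γ : ℝ → M)
    (b : ∀ τ, A (γ τ)) (t : ℝ) (b' : A (γ t)) : Prop :=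
  HasDerivAt (fun τ => coordAt N A (γ t) (γ τ) (b τ))
    (coordAt N A (γ t) (γ t) b' -
      connForm cov (γ t) (mfderiv 𝓘(ℝ, ℝ) (PhaseModel n) γ t (1 : ℝ))
        (coordAt N A (γ t) (γ t) (b t))) t

variable [VectorBundle ℝ (EndC N) A] [ContMDiffVectorBundle ∞ (EndC N) A (PhaseModel n)]
  {cov : CovariantDerivative (PhaseModel n) (EndC N) A} {γ : ℝ → M} {t : ℝ}

theorem isParallelAlong_iff {σ : ∀ τ, A (γ τ)} : IsParallelAlong cov γ σ ↔
    (∀ t, MDifferentiableAt 𝓘(ℝ, ℝ) (PhaseModel n) γ t) ∧ ∀ t, HasCovDerivAt cov γ σ t 0 := by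
  rw [← forall_and]
  refine forall_congr' fun t => and_congr_right fun _ => ?_
  rw [HasCovDerivAt, coordAt_zero (mem_frameNhd _), zero_sub]
  rfl

theorem eventually_mem_frameNhd (hγ : ContinuousAt γ t) :
    ∀ᶠ τ in 𝓝 t, γ τ ∈ frameNhd N A (γ t) :=
  hγ (frameNhd_mem_nhds (γ t))

theorem HasCovDerivAt.sub (hγ : ContinuousAt γ t) {b c : ∀ τ, A (γ τ)} {b' c' : A (γ t)}
    (hb : HasCovDerivAt cov γ b t b') (hc : HasCovDerivAt cov γ c t c') :
    HasCovDerivAt cov γ (fun τ => b τ - c τ) t (b' - c') := by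
  have h := HasDerivAt.fun_sub hb hc
  have hx := mem_frameNhd (N := N) (A := A) (γ t)
  have hneg : ∀ v m, connForm cov (γ t) v (-m) = -connForm cov (γ t) v m := fun v m => by
    simpa using connForm_smul (γ t) v (-1) m
  refine (h.congr_of_eventuallyEq ?_).congr_deriv ?_
  · filter_upwards [eventually_mem_frameNhd (N := N) (A := A) hγ] with τ hτ
    exact coordAt_sub hτ _ _
  · rw [coordAt_sub hx, coordAt_sub hx, sub_eq_add_neg (coordAt N A (γ t) (γ t) (b t)),
      connForm_add, hneg]
    abel

variable (hA : IsStarAlgebraBundle N A) (hcov : IsStarConnection cov)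
include hA hcov

theorem HasCovDerivAt.mul (hγ : ContinuousAt γ t) {b c : ∀ τ, A (γ τ)} {b' c' : A (γ t)}
    (hb : HasCovDerivAt cov γ b t b') (hc : HasCovDerivAt cov γ c t c') :
    HasCovDerivAt cov γ (fun τ => b τ * c τ) t (b' * c t + b t * c') := by
  have h := HasDerivAt.fun_mul hb hc
  have hx := mem_frameNhd (N := N) (A := A) (γ t)
  refine (h.congr_of_eventuallyEq ?_).congr_deriv ?_
  · filter_upwards [eventually_mem_frameNhd (N := N) (A := A) hγ] with τ hτ
    exact coordAt_mul hA hτ _ _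
  · rw [coordAt_add hx, coordAt_mul hA hx, coordAt_mul hA hx, coordAt_mul hA hx,
      connForm_mul hA hcov]
    noncomm_ring

theorem HasCovDerivAt.star (hγ : ContinuousAt γ t) {b : ∀ τ, A (γ τ)} {b' : A (γ t)}
    (hb : HasCovDerivAt cov γ b t b') :
    HasCovDerivAt cov γ (fun τ => Star.star (b τ)) t (Star.star b') := by
  have h := HasDerivAt.star hb
  have hx := mem_frameNhd (N := N) (A := A) (γ t)
  refine (h.congr_of_eventuallyEq ?_).congr_deriv ?_
  · filter_upwards [eventually_mem_frameNhd (N := N) (A := A) hγ] with τ hτ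
    exact coordAt_star hA hτ _
  · rw [coordAt_star hA hx, coordAt_star hA hx, connForm_star hA hcov, star_sub]

theorem hasCovDerivAt_smul_one (hγ : ContinuousAt γ t) (c : ℂ) :
    HasCovDerivAt cov γ (fun τ => c • (1 : A (γ τ))) t 0 := by
  have hx := mem_frameNhd (N := N) (A := A) (γ t)
  refine ((hasDerivAt_const t (c • (1 : EndC N))).congr_of_eventuallyEq ?_).congr_deriv ?_
  · filter_upwards [eventually_mem_frameNhd (N := N) (A := A) hγ] with τ hτ
    rw [coordAt_smul hA hτ, coordAt_one hA hτ]
  · rw [coordAt_zero hx, coordAt_smul hA hx, coordAt_one hA hx, connForm_smul_one hA hcov, sub_zero]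

/-- The connection form contributes nothing since the trace vanishes on derivations. -/
theorem HasCovDerivAt.fiberTrace (hγ : ContinuousAt γ t) {b : ∀ τ, A (γ τ)} {b' : A (γ t)}
    (hb : HasCovDerivAt cov γ b t b') :
    HasDerivAt (fun τ => fiberTrace N (γ τ) (b τ)) (_root_.fiberTrace N (γ t) b') t := by
  have hx := mem_frameNhd (N := N) (A := A) (γ t)
  let T : EndC N →L[ℝ] ℂ := ((endTrace N).restrictScalars ℝ).toContinuousLinearMap
  have h := T.hasFDerivAt.comp_hasDerivAt t hb
  refine (h.congr_of_eventuallyEq ?_).congr_deriv ?_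
  · filter_upwards [eventually_mem_frameNhd (N := N) (A := A) hγ] with τ hτ
    exact fiberTrace_eq hA hτ _
  · change endTrace N _ = _
    rw [map_sub, endTrace_connForm hA hcov, sub_zero, fiberTrace_eq hA hx]

/-- A section along a curve is determined by its covariant derivative and one value. -/
theorem eq_of_hasCovDerivAt_skew (hγ : Continuous γ) {b : ∀ τ, A (γ τ)} {b' : ∀ τ, A (γ τ)}
    (hb : ∀ t, HasCovDerivAt cov γ b t (b' t))
    (hskew : ∀ t, _root_.fiberTrace N (γ t) (Star.star (b' t) * b t + Star.star (b t) * b' t) = 0)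
    (s t : ℝ) (h0 : b s = 0) : b t = 0 := by
  -- The squared Hilbert–Schmidt norm is conserved; being zero at s, it is zero at t.
  have hd : ∀ t, HasDerivAt (fun τ => _root_.fiberTrace N (γ τ) (Star.star (b τ) * b τ)) 0 t :=
    fun t => by
      have h := ((hb t).star hA hcov hγ.continuousAt).mul hA hcov hγ.continuousAt (hb t)
      exact (h.fiberTrace hA hcov hγ.continuousAt).congr_deriv (hskew t)
  have hc := is_const_of_deriv_eq_zero (fun t => (hd t).differentiableAt)
    (fun t => (hd t).deriv) t s
  apply eq_zero_of_fiberTrace_star_mul_self hA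
  rw [hc, h0, mul_zero, fiberTrace_eq hA (mem_frameNhd _), coordAt_zero (mem_frameNhd _), map_zero]

/-- Makes `parallelTransport` independent of the chosen parallel section. -/
theorem IsParallelAlong.eq_of_eq {σ σ' : ∀ τ, A (γ τ)} (hσ : IsParallelAlong cov γ σ)
    (hσ' : IsParallelAlong cov γ σ') (s : ℝ) (h0 : σ s = σ' s) (t : ℝ) : σ t = σ' t := by
  rw [isParallelAlong_iff] at hσ hσ'
  have hγ : Continuous γ := continuous_iff_continuousAt.2 fun t => (hσ.1 t).continuousAt
  refine sub_eq_zero.1 (eq_of_hasCovDerivAt_skew hA hcov hγ (b := fun τ => σ τ - σ' τ)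
    (b' := fun τ => 0 - 0) (fun t => (hσ.2 t).sub hγ.continuousAt (hσ'.2 t)) (fun t => ?_) s t
    (sub_eq_zero.2 h0))
  rw [sub_zero, star_zero, zero_mul, mul_zero, add_zero, fiberTrace_eq hA (mem_frameNhd _),
    coordAt_zero (mem_frameNhd _), map_zero]

/-- Parallel transport is evaluation of any parallel section. -/
theorem IsParallelAlong.parallelTransport_eq {σ : ∀ τ, A (γ τ)} (hσ : IsParallelAlong cov γ σ)
    (s t : ℝ) : parallelTransport cov γ s t (σ s) = σ t := by
  have hex : ∃ σ' : ∀ τ, A (γ τ), IsParallelAlong cov γ σ' ∧ σ' s = σ s := ⟨σ, hσ, rfl⟩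
  rw [parallelTransport, dif_pos hex]
  exact hex.choose_spec.1.eq_of_eq hA hcov hσ s hex.choose_spec.2 t

end AlongCurve

/-! ### Smooth families of sections along a curve -/

section Families

variable {n N : ℕ} {M : Type*} [TopologicalSpace M] [ChartedSpace (PhaseSpace n) M]
  {A : M → Type*} [∀ x, Ring (A x)] [∀ x, Algebra ℂ (A x)] [∀ x, StarRing (A x)]
  [∀ x, TopologicalSpace (A x)] [TopologicalSpace (TotalSpace (EndC N) A)]
  [FiberBundle (EndC N) A] [∀ x, IsTopologicalAddGroup (A x)] [∀ x, ContinuousSMul ℝ (A x)]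
  [VectorBundle ℝ (EndC N) A] [ContMDiffVectorBundle ∞ (EndC N) A (PhaseModel n)]
  {cov : CovariantDerivative (PhaseModel n) (EndC N) A} {γ : ℝ → M} {t : ℝ}

theorem IsSmoothFamily.mdifferentiableAt {a : ℝ → Observables n N A} (ha : IsSmoothFamily a)
    (s : ℝ) (x : M) : MDifferentiableAt (𝓘(ℝ, ℝ).prod (PhaseModel n)) 𝓘(ℝ, EndC N)
      (fun q : ℝ × M => coordAt N A x q.2 (a q.1 q.2)) (s, x) :=
  ((mdifferentiableAt_totalSpace _ _).1 ((ha (s, x)).mdifferentiableAt (by simp))).2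

/-- The chain rule for a smooth family of sections along a curve with reversed time. -/
theorem IsSmoothFamily.hasCovDerivAt {a : ℝ → Observables n N A} (ha : IsSmoothFamily a)
    (hγ : MDifferentiableAt 𝓘(ℝ, ℝ) (PhaseModel n) γ t) (c : ℝ) {a' : A (γ t)}
    (ha' : HasDerivAt (fun τ => a τ (γ t)) a' (c - t)) :
    HasCovDerivAt cov γ (fun τ => a (c - τ) (γ τ)) t
      (cov (a (c - t)) (γ t) (mfderiv 𝓘(ℝ, ℝ) (PhaseModel n) γ t (1 : ℝ)) - a') := by
  have hx := mem_frameNhd (N := N) (A := A) (γ t)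
  let L : A (γ t) →L[ℝ] EndC N :=
    ((trivializationAt (EndC N) A (γ t)).continuousLinearEquivAt ℝ (γ t) hx : _ →L[ℝ] _)
  have hL : HasDerivAt (fun τ => coordAt N A (γ t) (γ t) (a τ (γ t)))
      (coordAt N A (γ t) (γ t) a') (c - t) := ha'.clm_comp_tvs L
  have h := hasDerivAt_along_curve (s := fun τ => c - τ) (ha.mdifferentiableAt (c - t) (γ t))
    ((hasDerivAt_id t).const_sub c) hγ hL
  refine HasDerivAt.congr_deriv h ?_
  have hs : MDifferentiableAt (PhaseModel n) ((PhaseModel n).prod 𝓘(ℝ, EndC N))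
      (fun y => TotalSpace.mk' (EndC N) y (a (c - t) y)) (γ t) :=
    ((a (c - t)).contMDiff (γ t)).mdifferentiableAt (by simp)
  rw [coordAt_sub hx, coordAt_cov cov _ hs, neg_one_smul]
  abel

end Families

/-! ### Linearity of the fiber trace and units in the fibers -/

section FiberTraceLinear

variable {N : ℕ} {M : Type*} [TopologicalSpace M]
  {A : M → Type*} [∀ x, Ring (A x)] [∀ x, Algebra ℂ (A x)] [∀ x, StarRing (A x)]
  [∀ x, TopologicalSpace (A x)] [TopologicalSpace (TotalSpace (EndC N) A)]
  [FiberBundle (EndC N) A] [VectorBundle ℝ (EndC N) A]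

theorem fiberTrace_sub (hA : IsStarAlgebraBundle N A) (x : M) (a b : A x) :
    fiberTrace N x (a - b) = fiberTrace N x a - fiberTrace N x b := by
  have hx := mem_frameNhd (N := N) (A := A) x
  rw [fiberTrace_eq hA hx, fiberTrace_eq hA hx, fiberTrace_eq hA hx, coordAt_sub hx, map_sub]

theorem fiberTrace_smul (hA : IsStarAlgebraBundle N A) (x : M) (c : ℂ) (a : A x) :
    fiberTrace N x (c • a) = c * fiberTrace N x a := by
  have hx := mem_frameNhd (N := N) (A := A) x
  rw [fiberTrace_eq hA hx, fiberTrace_eq hA hx, coordAt_smul hA hx, map_smul, smul_eq_mul]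

theorem fiberTrace_zero (hA : IsStarAlgebraBundle N A) (x : M) :
    fiberTrace N x (0 : A x) = 0 := by
  have hx := mem_frameNhd (N := N) (A := A) x
  rw [fiberTrace_eq hA hx, coordAt_zero hx, map_zero]

/-- The fiber is a finite dimensional complex vector space. -/
theorem finiteDimensional_fiber (hA : IsStarAlgebraBundle N A) (x : M) :
    FiniteDimensional ℂ (A x) := by
  have hx := mem_frameNhd (N := N) (A := A) x
  let f : A x →ₗ[ℂ] EndC N :=
    { toFun := coordAt N A x x
      map_add' := coordAt_add hx
      map_smul' := coordAt_smul hA hx }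
  exact FiniteDimensional.of_injective f (coordAt_injective hx)

/-- In the fibers, elements that are not left zero divisors are units. -/
theorem isUnit_of_mul_eq_zero (hA : IsStarAlgebraBundle N A) {x : M} {a : A x}
    (h : ∀ b, a * b = 0 → b = 0) : IsUnit a := by
  have := finiteDimensional_fiber hA x
  have hinj : Function.Injective (LinearMap.mulLeft ℂ a) :=
    (injective_iff_map_eq_zero _).2 h
  obtain ⟨b, hb⟩ := (LinearMap.injective_iff_surjective.1 hinj) 1
  change a * b = 1 at hb
  -- The right inverse b is also a left inverse, because a(ba - 1) = 0.
  refine ⟨⟨a, b, hb, sub_eq_zero.1 (h _ ?_)⟩, rfl⟩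
  rw [mul_sub, ← mul_assoc, hb, one_mul, mul_one, sub_self]

end FiberTraceLinear

/-! ### The Heisenberg equation along a curve -/

section Heisenberg

variable {n N : ℕ} {M : Type*} [TopologicalSpace M] [ChartedSpace (PhaseSpace n) M]
  {A : M → Type*} [∀ x, Ring (A x)] [∀ x, Algebra ℂ (A x)] [∀ x, StarRing (A x)]
  [∀ x, TopologicalSpace (A x)] [TopologicalSpace (TotalSpace (EndC N) A)]
  [FiberBundle (EndC N) A] [∀ x, IsTopologicalAddGroup (A x)] [∀ x, ContinuousSMul ℝ (A x)]

/-- `b` solves the Heisenberg equation `∇b = -i[h, b]` along `γ`. -/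
def IsHeisenbergAlong (cov : CovariantDerivative (PhaseModel n) (EndC N) A) (γ : ℝ → M)
    (h : ∀ τ, A (γ τ)) (b : ∀ τ, A (γ τ)) : Prop :=
  ∀ t, HasCovDerivAt cov γ b t (-(Complex.I • (h t * b t - b t * h t)))

variable [∀ x, StarModule ℂ (A x)]
  [VectorBundle ℝ (EndC N) A] [ContMDiffVectorBundle ∞ (EndC N) A (PhaseModel n)]
  {cov : CovariantDerivative (PhaseModel n) (EndC N) A} {γ : ℝ → M} {h b c u : ∀ τ, A (γ τ)}
  (hA : IsStarAlgebraBundle N A) (hcov : IsStarConnection cov) (hγ : Continuous γ)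

theorem HasCovDerivAt.congr_right {t : ℝ} {b' b'' : A (γ t)} (hb : HasCovDerivAt cov γ b t b')
    (e : b' = b'') : HasCovDerivAt cov γ b t b'' := e ▸ hb

namespace IsHeisenbergAlong
include hγ

theorem sub (hb : IsHeisenbergAlong cov γ h b) (hc : IsHeisenbergAlong cov γ h c) :
    IsHeisenbergAlong cov γ h fun τ => b τ - c τ := fun t =>
  ((hb t).sub hγ.continuousAt (hc t)).congr_right <| by
    simp only [smul_sub, mul_sub, sub_mul]
    abel

include hA hcov

/-- Both ∇ and [h, ·] are derivations. -/
theorem mul (hb : IsHeisenbergAlong cov γ h b) (hc : IsHeisenbergAlong cov γ h c) :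
    IsHeisenbergAlong cov γ h fun τ => b τ * c τ := fun t =>
  ((hb t).mul hA hcov hγ.continuousAt (hc t)).congr_right <| by
    simp only [smul_sub, mul_sub, sub_mul, neg_mul, mul_neg, smul_mul_assoc, mul_smul_comm,
      mul_assoc]
    abel

theorem star (hh : ∀ t, Star.star (h t) = h t) (hb : IsHeisenbergAlong cov γ h b) :
    IsHeisenbergAlong cov γ h fun τ => Star.star (b τ) := fun t =>
  ((hb t).star hA hcov hγ.continuousAt).congr_right <| by
    simp only [star_neg, star_smul, star_sub, star_mul, hh, Complex.star_def, Complex.conj_I,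
      neg_smul, smul_sub]
    abel

theorem smul_one (z : ℂ) : IsHeisenbergAlong cov γ h fun τ => z • (1 : A (γ τ)) := fun t =>
  (hasCovDerivAt_smul_one hA hcov hγ.continuousAt z).congr_right <| by simp

/-- The trace of a solution of the Heisenberg equation is constant. -/
theorem fiberTrace_eq (hb : IsHeisenbergAlong cov γ h b) (s t : ℝ) :
    fiberTrace N (γ s) (b s) = fiberTrace N (γ t) (b t) := by
  have hd : ∀ t, HasDerivAt (fun τ => fiberTrace N (γ τ) (b τ)) 0 t := fun t => by
    refine ((hb t).fiberTrace hA hcov hγ.continuousAt).congr_deriv ?_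
    rw [← neg_smul, fiberTrace_smul hA, fiberTrace_sub hA, fiberTrace_mul_comm hA, sub_self,
      mul_zero]
  exact is_const_of_deriv_eq_zero (fun t => (hd t).differentiableAt) (fun t => (hd t).deriv) s t

/-- The section b*b is again a solution, so Tr(b*b) is constant. -/
theorem eq_zero (hh : ∀ t, Star.star (h t) = h t) (hb : IsHeisenbergAlong cov γ h b) {s : ℝ}
    (hs : b s = 0) (t : ℝ) : b t = 0 := by
  apply eq_zero_of_fiberTrace_star_mul_self hA
  rw [((hb.star hA hcov hγ hh).mul hA hcov hγ hb).fiberTrace_eq hA hcov hγ t s, hs, mul_zero,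
    fiberTrace_zero hA]

theorem star_eq (hh : ∀ t, Star.star (h t) = h t) (hb : IsHeisenbergAlong cov γ h b) {s : ℝ}
    (hs : Star.star (b s) = b s) (t : ℝ) : Star.star (b t) = b t :=
  sub_eq_zero.1 (((hb.star hA hcov hγ hh).sub hγ hb).eq_zero hA hcov hγ hh (sub_eq_zero.2 hs) t)

end IsHeisenbergAlong

include hA hcov hγ

/-- Solutions of `∇u = -ihu` that are unitary at one time are unitary. -/
theorem star_mul_self_of_hasCovDerivAt (hh : ∀ t, star (h t) = h t)
    (hu : ∀ t, HasCovDerivAt cov γ u t (-(Complex.I • (h t * u t)))) {s : ℝ} (hs : u s = 1)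
    (t : ℝ) : star (u t) * u t = 1 := by
  have hone : ∀ t, HasCovDerivAt cov γ (fun τ => (1 : A (γ τ))) t 0 := fun t => by
    simpa using hasCovDerivAt_smul_one hA hcov (γ := γ) (t := t) hγ.continuousAt 1
  -- With h Hermitian, the terms iu*hu and -iu*hu cancel.
  have hW : ∀ t, HasCovDerivAt cov γ (fun τ => star (u τ) * u τ - 1) t 0 := fun t => by
    refine ((((hu t).star hA hcov hγ.continuousAt).mul hA hcov hγ.continuousAt (hu t)).sub
      hγ.continuousAt (hone t)).congr_right ?_
    simp only [star_neg, star_smul, star_mul, hh, Complex.star_def, Complex.conj_I, neg_smul,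
      neg_neg, smul_mul_assoc, mul_neg, mul_smul_comm, mul_assoc]
    abel
  refine sub_eq_zero.1 (eq_of_hasCovDerivAt_skew hA hcov hγ (b := fun τ => star (u τ) * u τ - 1)
    (b' := fun _ => 0) hW (fun t => ?_) s t ?_)
  · rw [star_zero, zero_mul, mul_zero, add_zero, fiberTrace_zero hA]
  · simp [hs]

/-- Conjugating a Heisenberg solution by a Schrödinger solution gives a parallel section. -/
theorem IsHeisenbergAlong.isParallelAlong_conj (hh : ∀ t, Star.star (h t) = h t)
    (hγ' : ∀ t, MDifferentiableAt 𝓘(ℝ, ℝ) (PhaseModel n) γ t)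
    (hu : ∀ t, HasCovDerivAt cov γ u t (-(Complex.I • (h t * u t))))
    (hb : IsHeisenbergAlong cov γ h b) :
    IsParallelAlong cov γ fun τ => Star.star (u τ) * b τ * u τ := by
  refine isParallelAlong_iff.2 ⟨hγ', fun t => ?_⟩
  refine ((((hu t).star hA hcov hγ.continuousAt).mul hA hcov hγ.continuousAt (hb t)).mul hA hcov
    hγ.continuousAt (hu t)).congr_right ?_
  simp only [star_neg, star_smul, star_mul, hh, Complex.star_def, Complex.conj_I, neg_smul,
    neg_neg, smul_mul_assoc, mul_neg, neg_mul, mul_smul_comm, mul_assoc, mul_sub, sub_mul, smul_sub,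
    add_mul]
  abel

end Heisenberg

/-! ### Time evolution along Hamiltonian trajectories -/

section Evolution

variable {n N : ℕ} {M : Type*} [TopologicalSpace M] [ChartedSpace (PhaseSpace n) M]
  {Ω : SymplecticForm n M}
  {A : M → Type*} [∀ x, Ring (A x)] [∀ x, Algebra ℂ (A x)] [∀ x, StarRing (A x)]
  [∀ x, TopologicalSpace (A x)] [TopologicalSpace (TotalSpace (EndC N) A)]
  [FiberBundle (EndC N) A] [∀ x, IsTopologicalAddGroup (A x)] [∀ x, ContinuousSMul ℝ (A x)]
  [∀ x, StarModule ℂ (A x)]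
  [VectorBundle ℝ (EndC N) A] [ContMDiffVectorBundle ∞ (EndC N) A (PhaseModel n)]
  {cov : CovariantDerivative (PhaseModel n) (EndC N) A} {H₀ : M → ℝ} {H₁ : Observables n N A}
  {φ : ℝ → M → M} {Φ : ℝ → Observables n N A → Observables n N A} {U : ℝ → Observables n N A}

theorem SymplecticForm.IsHamiltonianFlow.mdifferentiableAt (hφ : Ω.IsHamiltonianFlow H₀ φ) (x : M)
    (t : ℝ) : MDifferentiableAt 𝓘(ℝ, ℝ) (PhaseModel n) (fun τ => φ τ x) t :=
  (hφ.integralCurve x t).mdifferentiableAt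

theorem SymplecticForm.IsHamiltonianFlow.continuous (hφ : Ω.IsHamiltonianFlow H₀ φ) (x : M) :
    Continuous fun τ => φ τ x :=
  (hφ.integralCurve x).continuous

theorem SymplecticForm.IsHamiltonianFlow.mfderiv_eq (hφ : Ω.IsHamiltonianFlow H₀ φ) (x : M)
    (t : ℝ) : mfderiv 𝓘(ℝ, ℝ) (PhaseModel n) (fun τ => φ τ x) t (1 : ℝ) =
      Ω.hamiltonianVectorField H₀ (φ t x) := by
  rw [(hφ.integralCurve x t).mfderiv]
  exact one_smul ℝ _

/-- The velocity of the trajectory is the Hamiltonian vector field, so differentiating in the base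
point yields {H₀, ·}, while reversed time yields -{H₀, ·} - i[H₁, ·]. The shift c chooses the moment
τ = c at which the initial section appears. -/
theorem IsTimeEvolution.isHeisenbergAlong (hΦ : IsTimeEvolution Ω cov H₀ H₁ Φ)
    (hφ : Ω.IsHamiltonianFlow H₀ φ) (c : ℝ) (s : Observables n N A) (x : M) :
    IsHeisenbergAlong cov (fun τ => φ τ x) (fun τ => H₁ (φ τ x)) fun τ => Φ (c - τ) s (φ τ x) :=
  fun t => ((hΦ.smooth s).hasCovDerivAt (hφ.mdifferentiableAt x t) c
    (hΦ.equation s (c - t) (φ t x))).congr_right <| by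
      rw [hφ.mfderiv_eq, hybridBracket]
      abel

theorem IsEvolutionOperator.hasCovDerivAt (hU : IsEvolutionOperator Ω cov H₀ H₁ U)
    (hφ : Ω.IsHamiltonianFlow H₀ φ) (c : ℝ) (x : M) (t : ℝ) :
    HasCovDerivAt cov (fun τ => φ τ x) (fun τ => U (c - τ) (φ τ x)) t
      (-(Complex.I • (H₁ (φ t x) * U (c - t) (φ t x)))) :=
  (hU.smooth.hasCovDerivAt (hφ.mdifferentiableAt x t) c
    (hU.equation (c - t) (φ t x))).congr_right <| by
      rw [hφ.mfderiv_eq, hybridBracket]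
      abel

variable (hA : IsStarAlgebraBundle N A) (hcov : IsStarConnection cov)
  (hφ : Ω.IsHamiltonianFlow H₀ φ) (hH₁ : ∀ x, star (H₁ x) = H₁ x)
include hA hcov hφ

/-- Pointwise form of the duality. The shifts t for s and 0 for ρ make the product start at Φ(t)s ·
ρ for τ = 0 and end at s · Φ(-t)ρ for τ = t. -/
theorem IsTimeEvolution.fiberTrace_mul (hΦ : IsTimeEvolution Ω cov H₀ H₁ Φ) (t : ℝ)
    (s ρ : Observables n N A) (x : M) :
    fiberTrace N (φ t x) (s (φ t x) * Φ (-t) ρ (φ t x)) = fiberTrace N x (Φ t s x * ρ x) := by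
  have h := ((hΦ.isHeisenbergAlong hφ t s x).mul hA hcov (hφ.continuous x)
    (hΦ.isHeisenbergAlong hφ 0 ρ x)).fiberTrace_eq hA hcov (hφ.continuous x) t 0
  simp only [sub_self, zero_sub, sub_zero, hΦ.start] at h
  rwa [hφ.start] at h

theorem IsTimeEvolution.fiberTrace_neg (hΦ : IsTimeEvolution Ω cov H₀ H₁ Φ) (t : ℝ)
    (ρ : Observables n N A) (x : M) :
    fiberTrace N (φ t x) (Φ (-t) ρ (φ t x)) = fiberTrace N x (ρ x) := by
  have h := (hΦ.isHeisenbergAlong hφ 0 ρ x).fiberTrace_eq hA hcov (hφ.continuous x) t 0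
  simp only [zero_sub, sub_zero, hΦ.start] at h
  rwa [hφ.start] at h

include hH₁

theorem IsTimeEvolution.star_eq (hΦ : IsTimeEvolution Ω cov H₀ H₁ Φ) (t : ℝ)
    {ρ : Observables n N A} (hρ : ∀ x, star (ρ x) = ρ x) (x : M) :
    star (Φ t ρ x) = Φ t ρ x := by
  have h := (hΦ.isHeisenbergAlong hφ t ρ x).star_eq hA hcov (hφ.continuous x)
    (fun τ => hH₁ (φ τ x)) (s := t) (by simp only [sub_self, hΦ.start, hρ]) 0
  simp only [sub_zero] at h
  rwa [hφ.start] at h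

theorem IsEvolutionOperator.star_mul_self (hU : IsEvolutionOperator Ω cov H₀ H₁ U) (t : ℝ) (x : M) :
    star (U t x) * U t x = 1 := by
  have h := star_mul_self_of_hasCovDerivAt hA hcov (hφ.continuous x) (fun τ => hH₁ (φ τ x))
    (hU.hasCovDerivAt hφ t x) (s := t) (by rw [sub_self, hU.start]) 0
  simp only [sub_zero] at h
  rwa [hφ.start] at h

/-- The relation U*U = 1 excludes left zero divisors, which suffices in a finite dimensional fiber.
-/
theorem IsEvolutionOperator.isUnit (hU : IsEvolutionOperator Ω cov H₀ H₁ U) (t : ℝ) (x : M) :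
    IsUnit (U t x) := by
  refine isUnit_of_mul_eq_zero hA fun b hb => ?_
  rw [← one_mul b, ← hU.star_mul_self hA hcov hφ hH₁ t x, mul_assoc, hb, mul_zero]

theorem IsEvolutionOperator.inverse_eq_star (hU : IsEvolutionOperator Ω cov H₀ H₁ U) (t : ℝ)
    (x : M) : Ring.inverse (U t x) = star (U t x) := by
  have h := Ring.mul_inverse_cancel _ (hU.isUnit hA hcov hφ hH₁ t x)
  rw [← one_mul (Ring.inverse _), ← hU.star_mul_self hA hcov hφ hH₁ t x, mul_assoc, h, mul_one]

/-- The backward Heisenberg evolution is conjugation by the evolution operator followed by parallel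
transport. -/
theorem IsTimeEvolution.eq_parallelTransport (hΦ : IsTimeEvolution Ω cov H₀ H₁ Φ)
    (hU : IsEvolutionOperator Ω cov H₀ H₁ U) (ρ : Observables n N A) (t : ℝ) (y : M) :
    TotalSpace.mk' (EndC N) y (Φ (-t) ρ y) =
        TotalSpace.mk' (EndC N) (φ 0 y)
          (parallelTransport cov (fun τ => φ τ y) (-t) 0
            (Ring.inverse (U t (φ (-t) y)) * ρ (φ (-t) y) * U t (φ (-t) y))) := by
  -- The parallel section is U(-τ)* Φ(-t - τ)ρ U(-τ): at τ = -t it is U(t)*ρU(t), and at τ = 0 it is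
  -- Φ(-t)ρ.
  have h := ((hΦ.isHeisenbergAlong hφ (-t) ρ y).isParallelAlong_conj hA hcov (hφ.continuous y)
    (fun τ => hH₁ (φ τ y)) (hφ.mdifferentiableAt y)
    (hU.hasCovDerivAt hφ 0 y)).parallelTransport_eq hA hcov (-t) 0
  simp only [sub_self, sub_zero, zero_sub, neg_neg, hΦ.start, hU.start, star_one, one_mul,
    mul_one] at h
  rw [hU.inverse_eq_star hA hcov hφ hH₁, h]
  -- The point φ 0 y equals y only propositionally, so the two fibers are compared in the total
  -- space.
  have : ∀ z, z = y → TotalSpace.mk' (EndC N) y (Φ (-t) ρ y) =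
      TotalSpace.mk' (EndC N) z (Φ (-t) ρ z) := by
    rintro z rfl; rfl
  exact this _ (hφ.start y)

end Evolution

/-! ### Constructing smooth sections; time reversal -/

section Sections

variable {n N : ℕ} {M : Type*} [TopologicalSpace M] [ChartedSpace (PhaseSpace n) M]
  {A : M → Type*} [∀ x, Ring (A x)] [∀ x, Algebra ℂ (A x)] [∀ x, StarRing (A x)]
  [∀ x, TopologicalSpace (A x)] [TopologicalSpace (TotalSpace (EndC N) A)]
  [FiberBundle (EndC N) A] [∀ x, IsTopologicalAddGroup (A x)] [∀ x, ContinuousSMul ℝ (A x)]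
  [VectorBundle ℝ (EndC N) A] [ContMDiffVectorBundle ∞ (EndC N) A (PhaseModel n)]

theorem contMDiffAt_iff_coordAt {σ : ∀ x, A x} {x : M} :
    ContMDiffAt (PhaseModel n) ((PhaseModel n).prod 𝓘(ℝ, EndC N)) ∞
      (fun y => TotalSpace.mk' (EndC N) y (σ y)) x ↔
    ContMDiffAt (PhaseModel n) 𝓘(ℝ, EndC N) ∞ (fun y => coordAt N A x y (σ y)) x :=
  Bundle.contMDiffAt_section x

/-- Every fiber element is the value of a smooth section. -/
theorem exists_observable_eq [IsManifold (PhaseModel n) ∞ M] [T2Space M] (x : M) (b : A x) :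
    ∃ s : Observables n N A, s x = b := by
  obtain ⟨u, hu, hs⟩ := FiberBundle.exists_contMDiffOn_extend (k := ∞) (PhaseModel n) (EndC N) b
  obtain ⟨f, -, hf⟩ := (SmoothBumpFunction.nhds_basis_tsupport (I := PhaseModel n) x).mem_iff.1
    (interior_mem_nhds.2 hu)
  refine ⟨⟨(f : M → ℝ) • FiberBundle.extend (EndC N) b, ContMDiffOn.smul_section_of_tsupport
    f.contMDiff.contMDiffOn isOpen_interior hf (hs.mono interior_subset)⟩, ?_⟩
  change f x • FiberBundle.extend (EndC N) b x = b
  rw [f.eq_one, one_smul, FiberBundle.extend_apply_self]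

/-- The adjoint of a smooth section. -/
def starObservable (hA : IsStarAlgebraBundle N A) (s : Observables n N A) : Observables n N A :=
  ⟨fun x => star (s x), fun x => contMDiffAt_iff_coordAt.2 <| by
    have h := contMDiffAt_iff_coordAt.1 (s.contMDiff x)
    have hstar : ContMDiff 𝓘(ℝ, EndC N) 𝓘(ℝ, EndC N) ∞ (fun a : EndC N => star a) :=
      (starL' ℝ : EndC N ≃L[ℝ] EndC N).contDiff.contMDiff
    refine (hstar.contMDiffAt.comp x h).congr_of_eventuallyEq ?_
    filter_upwards [frameNhd_mem_nhds (N := N) (A := A) x] with y hy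
    exact coordAt_star hA hy _⟩

theorem continuous_fiberTrace_mul (hA : IsStarAlgebraBundle N A) (s ρ : Observables n N A) :
    Continuous fun x => fiberTrace N x (s x * ρ x) := by
  refine continuous_iff_continuousAt.2 fun x => ?_
  have hs := (contMDiffAt_iff_coordAt.1 (s.contMDiff x)).continuousAt
  have hρ := (contMDiffAt_iff_coordAt.1 (ρ.contMDiff x)).continuousAt
  have hT : Continuous (endTrace N) := (endTrace N).continuous_of_finiteDimensional
  refine (hT.continuousAt.comp (hs.mul hρ)).congr ?_
  filter_upwards [frameNhd_mem_nhds (N := N) (A := A) x] with y hy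
  rw [fiberTrace_eq hA hy, coordAt_mul hA hy]
  rfl

theorem IsSmoothFamily.comp_neg {a : ℝ → Observables n N A} (ha : IsSmoothFamily a) :
    IsSmoothFamily fun t => a (-t) := by
  have h : ContMDiff (𝓘(ℝ, ℝ).prod (PhaseModel n)) (𝓘(ℝ, ℝ).prod (PhaseModel n)) ∞
      fun q : ℝ × M => (-q.1, q.2) :=
    (contDiff_neg.contMDiff.comp contMDiff_fst).prodMk contMDiff_snd
  exact ContMDiff.comp ha h

/-- Time reversal of a derivative in a space isomorphic to a normed space. -/
theorem HasDerivAt.comp_neg_tvs {F G : Type*} [AddCommGroup F] [Module ℝ F] [TopologicalSpace F]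
    [ContinuousSMul ℝ F] [NormedAddCommGroup G] [NormedSpace ℝ G] (L : F ≃L[ℝ] G) {f : ℝ → F}
    {f' : F} {t : ℝ} (hf : HasDerivAt f f' (-t)) : HasDerivAt (fun τ => f (-τ)) (-f') t := by
  have h := hf.clm_comp_tvs (L : F →L[ℝ] G)
  have h2 := (h.scomp t (hasDerivAt_neg t)).clm_comp_tvs (L.symm : G →L[ℝ] F)
  simpa [Function.comp_def] using h2

end Sections

/-! ### Spectrum and equation of motion of the evolved state -/

section EvolutionSpectrum

variable {n N : ℕ} {M : Type*} [TopologicalSpace M] [ChartedSpace (PhaseSpace n) M]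
  [IsManifold (PhaseModel n) ∞ M] [T2Space M] {Ω : SymplecticForm n M}
  {A : M → Type*} [∀ x, Ring (A x)] [∀ x, Algebra ℂ (A x)] [∀ x, StarRing (A x)]
  [∀ x, TopologicalSpace (A x)] [TopologicalSpace (TotalSpace (EndC N) A)]
  [FiberBundle (EndC N) A] [∀ x, IsTopologicalAddGroup (A x)] [∀ x, ContinuousSMul ℝ (A x)]
  [∀ x, StarModule ℂ (A x)]
  [VectorBundle ℝ (EndC N) A] [ContMDiffVectorBundle ∞ (EndC N) A (PhaseModel n)]
  {cov : CovariantDerivative (PhaseModel n) (EndC N) A} {H₀ : M → ℝ} {H₁ : Observables n N A}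
  {φ : ℝ → M → M} {Φ : ℝ → Observables n N A → Observables n N A}

/-- The spectrum is transported along the flow. -/
theorem IsTimeEvolution.spectrum_subset (hA : IsStarAlgebraBundle N A) (hcov : IsStarConnection cov)
    (hφ : Ω.IsHamiltonianFlow H₀ φ) (hH₁ : ∀ x, star (H₁ x) = H₁ x)
    (hΦ : IsTimeEvolution Ω cov H₀ H₁ Φ) (t : ℝ) (ρ : Observables n N A) (y : M) :
    spectrum ℂ (Φ (-t) ρ y) ⊆ spectrum ℂ (ρ (φ (-t) y)) := by
  intro z hz hunit
  refine hz (isUnit_of_mul_eq_zero hA fun b hb => ?_)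
  -- Extending b to a global section lets Φ carry it along the trajectory. The product (z - ρ)b
  -- stays zero; at τ = -t the first factor is invertible, so the transported b vanishes there,
  -- hence also at τ = 0.
  obtain ⟨s, hs⟩ := exists_observable_eq (n := n) (N := N) y b
  have hγ := hφ.continuous y
  have hh : ∀ τ, star (H₁ (φ τ y)) = H₁ (φ τ y) := fun τ => hH₁ (φ τ y)
  have hS := hΦ.isHeisenbergAlong hφ 0 s y
  have hX := ((IsHeisenbergAlong.smul_one hA hcov hγ (h := fun τ => H₁ (φ τ y)) z).sub hγ
    (hΦ.isHeisenbergAlong hφ (-t) ρ y)).mul hA hcov hγ hS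
  have h0 : (z • (1 : A (φ 0 y)) - Φ (-t - 0) ρ (φ 0 y)) * Φ (0 - 0) s (φ 0 y) = 0 := by
    have : ∀ w, w = y → (z • (1 : A w) - Φ (-t) ρ w) * s w = 0 := by
      rintro w rfl
      rw [hs, ← hb, Algebra.algebraMap_eq_smul_one]
    rw [sub_zero, sub_zero, hΦ.start]
    exact this _ (hφ.start y)
  have h1 := hX.eq_zero hA hcov hγ hh h0 (-t)
  rw [sub_self, hΦ.start, ← Algebra.algebraMap_eq_smul_one] at h1
  have h2 := (hunit.mul_right_eq_zero).1 h1
  have h3 := hS.eq_zero hA hcov hγ hh h2 0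
  simp only [sub_zero, hΦ.start] at h3
  rw [hφ.start] at h3
  rw [← hs, h3]

theorem IsTimeEvolution.hasDerivAt_neg (hΦ : IsTimeEvolution Ω cov H₀ H₁ Φ)
    (ρ : Observables n N A) (t : ℝ) (x : M) :
    HasDerivAt (fun τ => Φ (-τ) ρ x)
      (-hybridBracket Ω cov H₀ (Φ (-t) ρ) x -
        Complex.I • (H₁ x * Φ (-t) ρ x - Φ (-t) ρ x * H₁ x)) t := by
  rw [← neg_add']
  exact HasDerivAt.comp_neg_tvs
    ((trivializationAt (EndC N) A x).continuousLinearEquivAt ℝ x (mem_frameNhd x))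
    (hΦ.equation ρ (-t) x)

end EvolutionSpectrum

/-! ### Symplectic maps in charts and their Jacobians -/

section ChartRepresentative

variable {n : ℕ} {M : Type*} [TopologicalSpace M] [ChartedSpace (PhaseSpace n) M]

/-- The expression of a map in the preferred charts at `p` and `q`. -/
def chartRep (n : ℕ) {M : Type*} [TopologicalSpace M] [ChartedSpace (PhaseSpace n) M]
    (p q : M) (f : M → M) (u : PhaseSpace n) : PhaseSpace n :=
  extChartAt (PhaseModel n) q (f ((extChartAt (PhaseModel n) p).symm u))

/-- The part of the domain of the chart at `p` that `f` maps to the domain of the chart at `q`. -/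
def chartOverlap (n : ℕ) {M : Type*} [TopologicalSpace M] [ChartedSpace (PhaseSpace n) M]
    (p q : M) (f : M → M) : Set M :=
  (extChartAt (PhaseModel n) p).source ∩ f ⁻¹' (extChartAt (PhaseModel n) q).source

variable [IsManifold (PhaseModel n) ∞ M]

theorem mdifferentiableAt_extChartAt_symm {p : M} {u : PhaseSpace n}
    (hu : u ∈ (extChartAt (PhaseModel n) p).target) :
    MDifferentiableAt (PhaseModel n) (PhaseModel n) (extChartAt (PhaseModel n) p).symm u :=
  ((contMDiffOn_extChartAt_symm (n := ∞) p).contMDiffAt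
    ((isOpen_extChartAt_target p).mem_nhds hu)).mdifferentiableAt (by simp)

theorem mdifferentiableAt_extChartAt_of_mem {p x : M}
    (hx : x ∈ (extChartAt (PhaseModel n) p).source) :
    MDifferentiableAt (PhaseModel n) (PhaseModel n) (extChartAt (PhaseModel n) p) x := by
  rw [extChartAt_source] at hx
  exact (contMDiffAt_extChartAt' (n := ∞) hx).mdifferentiableAt (by simp)

theorem isInvertible_mfderiv_extChartAt_symm {p : M} {u : PhaseSpace n}
    (hu : u ∈ (extChartAt (PhaseModel n) p).target) :
    (mfderiv (PhaseModel n) (PhaseModel n) (extChartAt (PhaseModel n) p).symm u).IsInvertible := by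
  have h := isInvertible_mfderivWithin_extChartAt_symm (I := PhaseModel n) hu
  rwa [ModelWithCorners.Boundaryless.range_eq_univ, mfderivWithin_univ] at h

/-- Chain rule for g written near u as the inverse chart after the chart expression of g. -/
theorem mfderiv_symm_comp_fderiv {E : Type*} [NormedAddCommGroup E] [NormedSpace ℝ E] {q : M}
    {g : E → M} {u : E}
    (hg : MDifferentiableAt 𝓘(ℝ, E) (PhaseModel n) g u)
    (hq : g u ∈ (extChartAt (PhaseModel n) q).source) (a : E) :
    mfderiv (PhaseModel n) (PhaseModel n) (extChartAt (PhaseModel n) q).symm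
      (extChartAt (PhaseModel n) q (g u))
      (fderiv ℝ (fun z => extChartAt (PhaseModel n) q (g z)) u a) =
    mfderiv 𝓘(ℝ, E) (PhaseModel n) g u a := by
  have h1 : MDifferentiableAt 𝓘(ℝ, E) (PhaseModel n)
      (fun z => extChartAt (PhaseModel n) q (g z)) u :=
    (mdifferentiableAt_extChartAt_of_mem hq).comp u hg
  have h2 := mdifferentiableAt_extChartAt_symm ((extChartAt (PhaseModel n) q).map_source hq)
  have h3 := mfderiv_comp u h2 h1
  have h4 : (extChartAt (PhaseModel n) q).symm ∘ (fun z => extChartAt (PhaseModel n) q (g z))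
      =ᶠ[𝓝 u] g := by
    filter_upwards [hg.continuousAt.preimage_mem_nhds
      ((isOpen_extChartAt_source q).mem_nhds hq)] with z hz
    exact (extChartAt (PhaseModel n) q).left_inv hz
  rw [h4.mfderiv_eq, mfderiv_eq_fderiv] at h3
  exact (DFunLike.congr_fun h3 a).symm

theorem differentiableAt_chartRep {p q : M} {f : M → M} {u : PhaseSpace n}
    (hf : MDifferentiable (PhaseModel n) (PhaseModel n) f)
    (hu : u ∈ (extChartAt (PhaseModel n) p).target)
    (hq : f ((extChartAt (PhaseModel n) p).symm u) ∈ (extChartAt (PhaseModel n) q).source) :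
    DifferentiableAt ℝ (chartRep n p q f) u :=
  ((mdifferentiableAt_extChartAt_of_mem hq).comp u
    ((hf _).comp u (mdifferentiableAt_extChartAt_symm hu))).differentiableAt

theorem mfderiv_symm_chartRep {p q : M} {f : M → M} {u : PhaseSpace n}
    (hf : MDifferentiable (PhaseModel n) (PhaseModel n) f)
    (hu : u ∈ (extChartAt (PhaseModel n) p).target)
    (hq : f ((extChartAt (PhaseModel n) p).symm u) ∈ (extChartAt (PhaseModel n) q).source)
    (a : PhaseSpace n) :
    mfderiv (PhaseModel n) (PhaseModel n) (extChartAt (PhaseModel n) q).symm (chartRep n p q f u)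
      (fderiv ℝ (chartRep n p q f) u a) =
    mfderiv (PhaseModel n) (PhaseModel n) f ((extChartAt (PhaseModel n) p).symm u)
      (mfderiv (PhaseModel n) (PhaseModel n) (extChartAt (PhaseModel n) p).symm u a) := by
  have h := mfderiv_symm_comp_fderiv (g := fun z => f ((extChartAt (PhaseModel n) p).symm z))
    ((hf _).comp u (mdifferentiableAt_extChartAt_symm hu)) hq a
  refine h.trans ?_
  have h2 := mfderiv_comp u (hf _) (mdifferentiableAt_extChartAt_symm hu)
  exact DFunLike.congr_fun h2 a

/-- Vectors are typed in `PhaseSpace n`, so that the base point can change although `TangentSpace`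
depends on it. -/
theorem SymplecticForm.toForm_congr (Ω : SymplecticForm n M) {x y : M} (h : x = y)
    {a b a' b' : PhaseSpace n} (ha : a = a') (hb : b = b') :
    Ω.toForm x (![a, b] : Fin 2 → PhaseSpace n) =
      Ω.toForm y (![a', b'] : Fin 2 → PhaseSpace n) := by
  subst h ha hb; rfl

theorem formInChart_apply (Ω : ∀ x : M, TangentSpace (PhaseModel n) x [⋀^Fin 2]→L[ℝ] ℝ) (p : M)
    (u a b : PhaseSpace n) :
    formInChart Ω p u ![a, b] = Ω ((extChartAt (PhaseModel n) p).symm u)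
      ![mfderiv (PhaseModel n) (PhaseModel n) (extChartAt (PhaseModel n) p).symm u a,
        mfderiv (PhaseModel n) (PhaseModel n) (extChartAt (PhaseModel n) p).symm u b] := by
  change Ω _ (fun i => mfderiv (PhaseModel n) (PhaseModel n) (extChartAt (PhaseModel n) p).symm u
    ((![a, b] : Fin 2 → PhaseSpace n) i)) = _
  congr 1
  funext i
  fin_cases i <;> rfl

/-- `f` preserves the symplectic form. -/
structure SymplecticForm.IsSymplecticMap (Ω : SymplecticForm n M) (f : M → M) : Prop where
  contMDiff : ContMDiff (PhaseModel n) (PhaseModel n) ∞ f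
  toForm_mfderiv : ∀ (x : M) (a b : TangentSpace (PhaseModel n) x),
    Ω.toForm (f x) ![mfderiv (PhaseModel n) (PhaseModel n) f x a,
      mfderiv (PhaseModel n) (PhaseModel n) f x b] = Ω.toForm x ![a, b]

theorem SymplecticForm.IsSymplecticMap.id (Ω : SymplecticForm n M) :
    Ω.IsSymplecticMap (fun x => x) where
  contMDiff := contMDiff_id
  toForm_mfderiv x a b := by
    change Ω.toForm x ![mfderiv (PhaseModel n) (PhaseModel n) _root_.id x a,
      mfderiv (PhaseModel n) (PhaseModel n) _root_.id x b] = _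
    rw [mfderiv_id]
    rfl

variable {Ω : SymplecticForm n M} {f : M → M}

theorem SymplecticForm.IsSymplecticMap.formInChart_eq (hf : Ω.IsSymplecticMap f) {p q : M}
    {u : PhaseSpace n} (hu : u ∈ (extChartAt (PhaseModel n) p).target)
    (hq : f ((extChartAt (PhaseModel n) p).symm u) ∈ (extChartAt (PhaseModel n) q).source)
    (a b : PhaseSpace n) :
    formInChart Ω.toForm q (chartRep n p q f u)
      ![fderiv ℝ (chartRep n p q f) u a, fderiv ℝ (chartRep n p q f) u b] =
    formInChart Ω.toForm p u ![a, b] := by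
  have hd : MDifferentiable (PhaseModel n) (PhaseModel n) f := hf.contMDiff.mdifferentiable (by simp)
  exact (formInChart_apply _ _ _ _ _).trans <| (Ω.toForm_congr
    ((extChartAt (PhaseModel n) q).left_inv hq) (mfderiv_symm_chartRep hd hu hq a)
    (mfderiv_symm_chartRep hd hu hq b)).trans <| (hf.toForm_mfderiv _ _ _).trans
    (formInChart_apply _ _ _ _ _).symm

/-- The density of the Liouville measure in a chart. -/
def SymplecticForm.chartDensity (Ω : SymplecticForm n M) (p : M) (u : PhaseSpace n) : ENNReal :=
  ENNReal.ofReal (n.factorial * √|(Ω.coordMatrix p u).det|)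

/-- The bilinear form of an alternating 2-form. -/
def ContinuousAlternatingMap.toBilin {E : Type*} [NormedAddCommGroup E] [NormedSpace ℝ E]
    (w : E [⋀^Fin 2]→L[ℝ] ℝ) : E →ₗ[ℝ] E →ₗ[ℝ] ℝ :=
  have h0 : ∀ a c v : E, Function.update ![a, c] 0 v = ![v, c] := by
    intro a c v; ext i : 1; fin_cases i <;> rfl
  have h1 : ∀ a c v : E, Function.update ![a, c] 1 v = ![a, v] := by
    intro a c v; ext i : 1; fin_cases i <;> rfl
  LinearMap.mk₂ ℝ (fun v c => w ![v, c])
    (fun a b c => by simpa only [h0] using w.map_update_add ![a, c] 0 a b)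
    (fun r a c => by simpa only [h0] using w.map_update_smul ![a, c] 0 r a)
    (fun v a b => by simpa only [h1] using w.map_update_add ![v, a] 1 a b)
    (fun r v a => by simpa only [h1] using w.map_update_smul ![v, a] 1 r a)

@[simp]
theorem ContinuousAlternatingMap.toBilin_apply {E : Type*} [NormedAddCommGroup E] [NormedSpace ℝ E]
    (w : E [⋀^Fin 2]→L[ℝ] ℝ) (a b : E) : w.toBilin a b = w ![a, b] := rfl

theorem ContinuousAlternatingMap.toMatrix₂_toBilin {m : ℕ}
    (w : EuclideanSpace ℝ (Fin m) [⋀^Fin 2]→L[ℝ] ℝ) :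
    LinearMap.toMatrix₂ (EuclideanSpace.basisFun (Fin m) ℝ).toBasis
      (EuclideanSpace.basisFun (Fin m) ℝ).toBasis w.toBilin =
    Matrix.of fun j k : Fin m => w ![EuclideanSpace.single j 1, EuclideanSpace.single k 1] := by
  ext j k
  simp [LinearMap.toMatrix₂_apply]

/-- The Gram matrix of the pullback is JᵀWJ. -/
theorem ContinuousAlternatingMap.det_of_compContinuousLinearMap {m : ℕ}
    (w : EuclideanSpace ℝ (Fin m) [⋀^Fin 2]→L[ℝ] ℝ)
    (J : EuclideanSpace ℝ (Fin m) →L[ℝ] EuclideanSpace ℝ (Fin m)) :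
    (Matrix.of fun j k : Fin m => w ![J (EuclideanSpace.single j 1),
      J (EuclideanSpace.single k 1)]).det =
    J.det ^ 2 * (Matrix.of fun j k : Fin m => w ![EuclideanSpace.single j 1,
      EuclideanSpace.single k 1]).det := by
  let b := (EuclideanSpace.basisFun (Fin m) ℝ).toBasis
  have h := LinearMap.toMatrix₂_compl₁₂ b b b b w.toBilin J.toLinearMap J.toLinearMap
  have hJ : (Matrix.of fun j k : Fin m => w ![J (EuclideanSpace.single j 1),
      J (EuclideanSpace.single k 1)]) =
      LinearMap.toMatrix₂ b b (w.toBilin.compl₁₂ J.toLinearMap J.toLinearMap) := by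
    ext j k
    simp [LinearMap.toMatrix₂_apply, b]
  rw [hJ, h, ← w.toMatrix₂_toBilin, Matrix.det_mul, Matrix.det_mul, Matrix.det_transpose,
    LinearMap.det_toMatrix]
  change J.det * _ * J.det = _
  ring

/-- The determinant scales by the square of the Jacobian, so its root scales by exactly the factor
in the change of variables formula. -/
theorem SymplecticForm.IsSymplecticMap.chartDensity_eq (hf : Ω.IsSymplecticMap f) {p q : M}
    {u : PhaseSpace n} (hu : u ∈ (extChartAt (PhaseModel n) p).target)
    (hq : f ((extChartAt (PhaseModel n) p).symm u) ∈ (extChartAt (PhaseModel n) q).source) :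
    ENNReal.ofReal |(fderiv ℝ (chartRep n p q f) u).det| *
      Ω.chartDensity q (chartRep n p q f u) = Ω.chartDensity p u := by
  have h := ContinuousAlternatingMap.det_of_compContinuousLinearMap
    (formInChart Ω.toForm q (chartRep n p q f u)) (fderiv ℝ (chartRep n p q f) u)
  simp only [hf.formInChart_eq hu hq] at h
  change (Ω.coordMatrix p u).det = _ * (Ω.coordMatrix q _).det at h
  unfold SymplecticForm.chartDensity
  rw [h, ← ENNReal.ofReal_mul (abs_nonneg _), abs_mul, abs_pow, Real.sqrt_mul (by positivity),
    Real.sqrt_sq (abs_nonneg _)]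
  congr 1
  ring

end ChartRepresentative

/-! ### The Liouville measure -/

section Liouville

variable {n : ℕ} {M : Type*} [TopologicalSpace M] [ChartedSpace (PhaseSpace n) M]

theorem ContinuousOn.measurableSet_inter_preimage {X Y : Type*} [TopologicalSpace X]
    [MeasurableSpace X] [BorelSpace X] [TopologicalSpace Y] [MeasurableSpace Y] [BorelSpace Y]
    {g : X → Y} {s : Set X} (hg : ContinuousOn g s) (hs : MeasurableSet s) {B : Set Y}
    (hB : MeasurableSet B) : MeasurableSet (s ∩ g ⁻¹' B) := by
  have h : Measurable (fun x : s => g x) := (continuousOn_iff_continuous_domRestrict.1 hg).measurable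
  have h2 := hs.subtype_image (h hB)
  rwa [show Subtype.val '' ((fun x : s => g x) ⁻¹' B) = s ∩ g ⁻¹' B by
    ext x
    simp [and_comm]] at h2

variable [MeasurableSpace M]

/-- The coordinate measure of the domain of the preferred chart at `p`. -/
def SymplecticForm.chartMeasure (Ω : SymplecticForm n M) (p : M) : Measure M :=
  Measure.map (extChartAt (PhaseModel n) p).symm
    (((volume : Measure (PhaseSpace n)).withDensity (Ω.chartDensity p)).restrict
      (extChartAt (PhaseModel n) p).target)

variable [BorelSpace M]

theorem SymplecticForm.chartMeasure_apply (Ω : SymplecticForm n M) (p : M) {B : Set M}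
    (hB : MeasurableSet B) :
    Ω.chartMeasure p B = ∫⁻ u in (extChartAt (PhaseModel n) p).target ∩
      (extChartAt (PhaseModel n) p).symm ⁻¹' B, Ω.chartDensity p u := by
  have ht := (isOpen_extChartAt_target (I := PhaseModel n) p).measurableSet
  rw [SymplecticForm.chartMeasure, Measure.map_apply_of_aemeasurable
    ((continuousOn_extChartAt_symm p).aemeasurable ht) hB, Measure.restrict_apply' ht,
    withDensity_apply', Set.inter_comm]

theorem SymplecticForm.chartMeasure_inter_source (Ω : SymplecticForm n M) (p : M) {B : Set M}
    (hB : MeasurableSet B) :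
    Ω.chartMeasure p (B ∩ (extChartAt (PhaseModel n) p).source) = Ω.chartMeasure p B := by
  rw [Ω.chartMeasure_apply p hB,
    Ω.chartMeasure_apply p (hB.inter (isOpen_extChartAt_source p).measurableSet)]
  congr 2
  ext u
  simp only [Set.mem_inter_iff, Set.mem_preimage]
  exact ⟨fun h => ⟨h.1, h.2.1⟩, fun h => ⟨h.1, h.2, (extChartAt _ p).map_target h.1⟩⟩

variable [IsManifold (PhaseModel n) ∞ M] {Ω : SymplecticForm n M}

/-- Used for flow maps and also for the identity, where it says that different charts give the same
measure on their overlap. -/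
theorem SymplecticForm.IsSymplecticMap.chartMeasure_image {e : M ≃ₜ M} (he : Ω.IsSymplecticMap e)
    {p q : M} {B : Set M} (hB : MeasurableSet B) (hpq : B ⊆ chartOverlap n p q e) :
    Ω.chartMeasure q (e '' B) = Ω.chartMeasure p B := by
  have hd : MDifferentiable (PhaseModel n) (PhaseModel n) e := he.contMDiff.mdifferentiable (by simp)
  set S := (extChartAt (PhaseModel n) p).target ∩ (extChartAt (PhaseModel n) p).symm ⁻¹' B
    with hS
  have hSm : MeasurableSet S := (continuousOn_extChartAt_symm p).measurableSet_inter_preimage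
    (isOpen_extChartAt_target p).measurableSet hB
  have himg : (extChartAt (PhaseModel n) q).target ∩ (extChartAt (PhaseModel n) q).symm ⁻¹' (e '' B)
      = chartRep n p q e '' S := by
    ext w
    constructor
    · rintro ⟨hw, x, hx, hxw⟩
      have hxp := (hpq hx).1
      refine ⟨extChartAt (PhaseModel n) p x, ⟨(extChartAt _ p).map_source hxp, ?_⟩, ?_⟩
      · rwa [Set.mem_preimage, (extChartAt _ p).left_inv hxp]
      · rw [chartRep, (extChartAt _ p).left_inv hxp, hxw, (extChartAt _ q).right_inv hw]
    · rintro ⟨u, ⟨hu, huB⟩, rfl⟩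
      exact ⟨(extChartAt _ q).map_source (hpq huB).2, _, huB,
        ((extChartAt _ q).left_inv (hpq huB).2).symm⟩
  have hinj : Set.InjOn (chartRep n p q e) S := fun u hu w hw h =>
    (extChartAt _ p).symm.injOn hu.1 hw.1 <| e.injective <|
      (extChartAt _ q).injOn (hpq hu.2).2 (hpq hw.2).2 h
  rw [Ω.chartMeasure_apply p hB, Ω.chartMeasure_apply q (e.measurableEmbedding.measurableSet_image' hB),
    himg, lintegral_image_eq_lintegral_abs_det_fderiv_mul volume hSm (fun u hu =>
      (differentiableAt_chartRep hd hu.1 (hpq hu.2).2).hasFDerivAt.hasFDerivWithinAt) hinj]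
  exact setLIntegral_congr_fun hSm fun u hu => he.chartDensity_eq hu.1 (hpq hu.2).2

theorem SymplecticForm.liouvilleMeasure_eq_chartMeasure (Ω : SymplecticForm n M) {p : M} {B : Set M}
    (hB : MeasurableSet B) (hp : B ⊆ (extChartAt (PhaseModel n) p).source) :
    Ω.liouvilleMeasure B = Ω.chartMeasure p B := by
  have hsrc : ∀ q : M, MeasurableSet (extChartAt (PhaseModel n) q).source := fun q =>
    (isOpen_extChartAt_source (I := PhaseModel n) q).measurableSet
  refine le_antisymm ?_ (Measure.le_iff'.1 (le_iSup Ω.chartMeasure p) B)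
  -- A supremum of measures is hard to evaluate but easy to bound. This majorant is infinite on sets
  -- leaving the chart at p; on sets inside it, chart independence bounds every other chart measure
  -- by that of p. The added term vanishes on B.
  have hle : Ω.liouvilleMeasure ≤ Ω.chartMeasure p +
      ((⊤ : ENNReal) • Measure.count).restrict (extChartAt (PhaseModel n) p).sourceᶜ := by
    refine iSup_le fun q => Measure.le_iff.2 fun C hC => ?_
    change Ω.chartMeasure q C ≤ _
    rw [Measure.add_apply, Measure.restrict_apply hC]
    rcases (C ∩ (extChartAt (PhaseModel n) p).sourceᶜ).eq_empty_or_nonempty with h | h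
    · have hCp : C ⊆ (extChartAt (PhaseModel n) p).source := by
        rwa [← Set.disjoint_iff_inter_eq_empty, Set.disjoint_compl_right_iff_subset] at h
      have hid : Ω.IsSymplecticMap (Homeomorph.refl M) := SymplecticForm.IsSymplecticMap.id Ω
      have := hid.chartMeasure_image (p := p) (q := q) (hC.inter (hsrc q))
        (fun x hx => ⟨hCp hx.1, hx.2⟩)
      replace this : Ω.chartMeasure q (_root_.id '' (C ∩ (extChartAt (PhaseModel n) q).source)) =
        Ω.chartMeasure p (C ∩ (extChartAt (PhaseModel n) q).source) := this
      rw [Set.image_id, Ω.chartMeasure_inter_source q hC] at this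
      rw [this]
      exact (measure_mono Set.inter_subset_left).trans le_self_add
    · have : ((⊤ : ENNReal) • (Measure.count : Measure M)) (C ∩ (extChartAt (PhaseModel n) p).sourceᶜ)
          = ⊤ := by
        rw [Measure.smul_apply, smul_eq_mul, ENNReal.top_mul]
        exact Measure.count_ne_zero h
      rw [this, add_top]
      exact le_top
  refine (Measure.le_iff'.1 hle B).trans_eq ?_
  rw [Measure.add_apply, Measure.restrict_apply hB,
    Set.disjoint_iff_inter_eq_empty.1 (Set.disjoint_compl_right_iff_subset.2 hp), measure_empty,
    add_zero]

theorem SymplecticForm.IsSymplecticMap.measurePreserving [SecondCountableTopology M] {e : M ≃ₜ M}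
    (he : Ω.IsSymplecticMap e) :
    MeasurePreserving e Ω.liouvilleMeasure Ω.liouvilleMeasure := by
  -- The inverse is treated because its preimages are images under e. Second countability reduces
  -- the equality of measures to countably many sets that e maps from one chart into another.
  have h : MeasurePreserving e.symm Ω.liouvilleMeasure Ω.liouvilleMeasure := by
    refine ⟨e.symm.continuous.measurable, ?_⟩
    have hopen : ∀ x, IsOpen (chartOverlap n x (e x) e) := fun x =>
      (isOpen_extChartAt_source x).inter ((isOpen_extChartAt_source _).preimage e.continuous)
    obtain ⟨S, hS, hcov⟩ := TopologicalSpace.countable_cover_nhds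
      (f := fun x => chartOverlap n x (e x) e)
      fun x => (hopen x).mem_nhds ⟨mem_extChartAt_source x, mem_extChartAt_source (e x)⟩
    rw [Measure.ext_iff_of_biUnion_eq_univ hS hcov]
    intro x _
    refine Measure.ext fun C hC => ?_
    have hm := hC.inter (hopen x).measurableSet
    rw [Measure.restrict_apply hC, Measure.restrict_apply hC, Measure.map_apply
      e.symm.continuous.measurable hm, ← e.image_eq_preimage_symm,
      Ω.liouvilleMeasure_eq_chartMeasure hm (p := x) fun y hy => hy.2.1,
      Ω.liouvilleMeasure_eq_chartMeasure (e.measurableEmbedding.measurableSet_image' hm) (p := e x),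
      he.chartMeasure_image hm fun y hy => hy.2]
    rintro _ ⟨y, hy, rfl⟩
    exact hy.2.2
  exact MeasurePreserving.symm e.symm.toMeasurableEquiv h

theorem SymplecticForm.continuousOn_det_coordMatrix (Ω : SymplecticForm n M) (p : M) :
    ContinuousOn (fun u => (Ω.coordMatrix p u).det) (extChartAt (PhaseModel n) p).target := by
  refine (continuous_id.matrix_det).comp_continuousOn ?_
  refine continuousOn_pi.2 fun j => continuousOn_pi.2 fun k => ?_
  exact (((Ω.smooth p).differentiableOn (by simp)).continuousAlternatingMap_apply
    fun _ => differentiableOn_const _).continuousOn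

theorem SymplecticForm.det_coordMatrix_ne_zero (Ω : SymplecticForm n M) {p : M} {u : PhaseSpace n}
    (hu : u ∈ (extChartAt (PhaseModel n) p).target) : (Ω.coordMatrix p u).det ≠ 0 := by
  rw [SymplecticForm.coordMatrix, ← ContinuousAlternatingMap.toMatrix₂_toBilin,
    ← LinearMap.separatingLeft_iff_det_ne_zero]
  intro v hv
  obtain ⟨L, hL⟩ := isInvertible_mfderiv_extChartAt_symm hu
  have h : mfderiv (PhaseModel n) (PhaseModel n) (extChartAt (PhaseModel n) p).symm u v = 0 := by
    refine Ω.nondegenerate _ _ fun w => ?_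
    have h2 := (formInChart_apply _ _ _ _ _).symm.trans (hv (L.symm w))
    have h3 : mfderiv (PhaseModel n) (PhaseModel n) (extChartAt (PhaseModel n) p).symm u
        (L.symm w) = w := by
      rw [← hL]
      exact L.apply_symm_apply w
    rwa [h3] at h2
  rw [← hL] at h
  exact L.map_eq_zero_iff.1 h

/-- The density is bounded on a compact coordinate ball. This makes continuous compactly supported
integrands integrable. -/
instance SymplecticForm.isLocallyFiniteMeasure_liouvilleMeasure (Ω : SymplecticForm n M) :
    IsLocallyFiniteMeasure Ω.liouvilleMeasure := by
  refine ⟨fun x => ?_⟩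
  obtain ⟨r, hr, hball⟩ := Metric.nhds_basis_closedBall.mem_iff.1
    ((isOpen_extChartAt_target (I := PhaseModel n) x).mem_nhds (mem_extChartAt_target x))
  set V := (extChartAt (PhaseModel n) x).source ∩
    extChartAt (PhaseModel n) x ⁻¹' Metric.ball (extChartAt (PhaseModel n) x x) r
  have hV : IsOpen V := (continuousOn_extChartAt x).isOpen_inter_preimage
    (isOpen_extChartAt_source x) Metric.isOpen_ball
  refine ⟨V, hV.mem_nhds ⟨mem_extChartAt_source x, Metric.mem_ball_self hr⟩, ?_⟩
  rw [Ω.liouvilleMeasure_eq_chartMeasure hV.measurableSet Set.inter_subset_left,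
    Ω.chartMeasure_apply x hV.measurableSet]
  have hc := (((Ω.continuousOn_det_coordMatrix x).mono hball).abs.sqrt.const_mul
    (n.factorial : ℝ)).integrableOn_compact (μ := volume) (isCompact_closedBall _ _)
  refine (lintegral_mono_set ?_).trans_lt hc.lintegral_lt_top
  rintro u ⟨hu, hV⟩
  have := hV.2
  rw [Set.mem_preimage, (extChartAt _ x).right_inv hu] at this
  exact Metric.ball_subset_closedBall this

/-- Nondegeneracy makes the density positive. This upgrades almost everywhere equality of continuous
functions to equality. -/
instance SymplecticForm.isOpenPosMeasure_liouvilleMeasure (Ω : SymplecticForm n M) :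
    Ω.liouvilleMeasure.IsOpenPosMeasure := by
  refine ⟨fun V hV ⟨x, hx⟩ h0 => ?_⟩
  have hW := hV.inter (isOpen_extChartAt_source (I := PhaseModel n) x)
  have h1 := measure_mono_null (Set.inter_subset_left : V ∩ (extChartAt (PhaseModel n) x).source ⊆ V) h0
  rw [Ω.liouvilleMeasure_eq_chartMeasure hW.measurableSet Set.inter_subset_right,
    Ω.chartMeasure_apply x hW.measurableSet] at h1
  set S := (extChartAt (PhaseModel n) x).target ∩ (extChartAt (PhaseModel n) x).symm ⁻¹'
    (V ∩ (extChartAt (PhaseModel n) x).source)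
  have hS : IsOpen S := (continuousOn_extChartAt_symm x).isOpen_inter_preimage
    (isOpen_extChartAt_target x) hW
  have hSne : S.Nonempty := ⟨extChartAt (PhaseModel n) x x, mem_extChartAt_target x, by
    rw [Set.mem_preimage, extChartAt_to_inv]
    exact ⟨hx, mem_extChartAt_source x⟩⟩
  have hmeas : AEMeasurable (Ω.chartDensity x) (volume.restrict S) :=
    ((((Ω.continuousOn_det_coordMatrix x).mono Set.inter_subset_left).abs.sqrt.const_mul
      (n.factorial : ℝ)).aemeasurable hS.measurableSet).ennreal_ofReal
  rw [lintegral_eq_zero_iff' hmeas, Filter.EventuallyEq, ae_restrict_iff' hS.measurableSet] at h1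
  refine (hS.measure_pos volume hSne).ne' (measure_mono_null (fun u hu => ?_) h1)
  have hpos : 0 < |(Ω.coordMatrix x u).det| := abs_pos.2 (Ω.det_coordMatrix_ne_zero hu.1)
  simp only [Set.mem_ofPred_eq, Set.mem_compl_iff, not_forall]
  refine ⟨hu, ?_⟩
  simp only [SymplecticForm.chartDensity, Pi.zero_apply, ENNReal.ofReal_eq_zero, not_le]
  positivity

end Liouville

/-! ### Closed forms with exact contraction -/

section ClosedPullback

variable {E F : Type*} [NormedAddCommGroup E] [NormedSpace ℝ E] [NormedAddCommGroup F]
  [NormedSpace ℝ F]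

/-- A closed 2-form whose contraction with the constant vector `X` is exact does not depend on the
coordinate in the direction `X`. -/
theorem fderiv_apply_eq_zero_of_extDeriv_eq_zero {W : E → E [⋀^Fin 2]→L[ℝ] ℝ} {K : E → ℝ} {z : E}
    {X : E} (hW : DifferentiableAt ℝ W z) (hK : ContDiffAt ℝ 2 K z) (hclosed : extDeriv W z = 0)
    (hX : ∀ᶠ y in 𝓝 z, ∀ Y, W y ![X, Y] = fderiv ℝ K y Y) (Y Z : E) :
    fderiv ℝ (fun y => W y ![Y, Z]) z X = 0 := by
  have h := extDeriv_apply hW ![X, Y, Z]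
  have r0 : (0 : Fin 3).removeNth ![X, Y, Z] = ![Y, Z] := by
    ext i : 1; fin_cases i <;> rfl
  have r1 : (1 : Fin 3).removeNth ![X, Y, Z] = ![X, Z] := by
    ext i : 1; fin_cases i <;> rfl
  have r2 : (2 : Fin 3).removeNth ![X, Y, Z] = ![X, Y] := by
    ext i : 1; fin_cases i <;> rfl
  have hd : ∀ V, (fun y => W y ![X, V]) =ᶠ[𝓝 z] fun y => fderiv ℝ K y V := fun V => by
    filter_upwards [hX] with y hy using hy V
  have hK' : DifferentiableAt ℝ (fderiv ℝ K) z :=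
    (hK.fderiv_right (m := 1) (by norm_num)).differentiableAt (by simp)
  have hc : ∀ V V', fderiv ℝ (fun y => fderiv ℝ K y V) z V' = fderiv ℝ (fderiv ℝ K) z V' V := by
    intro V V'
    rw [fderiv_clm_apply hK' (differentiableAt_const V)]
    simp
  -- In dW(X, Y, Z) the two terms containing X as an argument of W are second derivatives of K, and
  -- they cancel by symmetry.
  have hsymm := hK.isSymmSndFDerivAt (by simp) Y Z
  rw [hclosed, Fin.sum_univ_three, r0, r1, r2, (hd Z).fderiv_eq, (hd Y).fderiv_eq] at h
  simp only [ContinuousAlternatingMap.coe_zero, Pi.zero_apply, Fin.val_zero, Fin.val_one,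
    Fin.val_two, pow_zero, pow_one, Matrix.cons_val_zero, Matrix.cons_val_one, Matrix.cons_val,
    hc, one_smul, neg_smul, even_two, Even.neg_pow, one_pow] at h
  linarith

end ClosedPullback

/-! ### Hamiltonian flows are symplectic and preserve the measure -/

section HamiltonianFlow

variable {n : ℕ} {M : Type*} [TopologicalSpace M] [ChartedSpace (PhaseSpace n) M]
  {Ω : SymplecticForm n M} {H : M → ℝ} {φ : ℝ → M → M}

theorem SymplecticForm.toForm_hamiltonianVectorField (Ω : SymplecticForm n M) (H : M → ℝ) (x : M)
    (w : TangentSpace (PhaseModel n) x) :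
    Ω.toForm x ![Ω.hamiltonianVectorField H x, w] = mfderiv (PhaseModel n) 𝓘(ℝ, ℝ) H x w :=
  (Ω.exists_hamiltonian_vector x (mfderiv (PhaseModel n) 𝓘(ℝ, ℝ) H x)).choose_spec w

variable [IsManifold (PhaseModel n) ∞ M]

namespace SymplecticForm.IsHamiltonianFlow

theorem contMDiff_apply (hφ : Ω.IsHamiltonianFlow H φ) (t : ℝ) :
    ContMDiff (PhaseModel n) (PhaseModel n) ∞ (φ t) :=
  hφ.smooth.comp (contMDiff_const.prodMk contMDiff_id)

/-- The field is the image of (∂_t, 0) at time 0 under the tangent map of the smooth flow, so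
smoothness needs no inversion of Ω. -/
theorem contMDiff_hamiltonianVectorField (hφ : Ω.IsHamiltonianFlow H φ) :
    ContMDiff (PhaseModel n) (PhaseModel n).tangent ∞
      fun x => (⟨x, Ω.hamiltonianVectorField H x⟩ : TangentBundle (PhaseModel n) M) := by
  have h1 := hφ.smooth.contMDiff_tangentMap (m := ∞) (by simp)
  have h2 : ContMDiff (PhaseModel n) (𝓘(ℝ, ℝ).tangent.prod (PhaseModel n).tangent) ∞
      fun x : M => ((⟨0, 1⟩ : TangentBundle 𝓘(ℝ, ℝ) ℝ),
        (⟨x, 0⟩ : TangentBundle (PhaseModel n) M)) :=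
    contMDiff_const.prodMk (Bundle.contMDiff_zeroSection ℝ (TangentSpace (PhaseModel n) : M → Type _))
  have h3 := h1.comp ((contMDiff_equivTangentBundleProd_symm (n := ∞) (I := 𝓘(ℝ, ℝ))
    (M := ℝ) (I' := PhaseModel n) (M' := M)).comp h2)
  refine h3.congr fun x => ?_
  have hι : HasMFDerivAt 𝓘(ℝ, ℝ) (𝓘(ℝ, ℝ).prod (PhaseModel n)) (fun τ : ℝ => (τ, x)) 0
      ((ContinuousLinearMap.id ℝ ℝ).prod (0 : ℝ →L[ℝ] PhaseSpace n)) :=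
    (hasMFDerivAt_id 0).prodMk (hasMFDerivAt_const x 0)
  have hF := ((hφ.smooth.mdifferentiable (by simp)) (0, x)).hasMFDerivAt
  have h4 := hasMFDerivAt_unique (hF.comp (0 : ℝ) hι) (hφ.integralCurve x 0)
  have h5 : mfderiv (𝓘(ℝ, ℝ).prod (PhaseModel n)) (PhaseModel n) (fun q : ℝ × M => φ q.1 q.2) (0, x)
      ((1 : ℝ), (0 : PhaseSpace n)) = Ω.hamiltonianVectorField H (φ 0 x) :=
    (DFunLike.congr_fun h4 (1 : ℝ)).trans (one_smul ℝ _)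
  have h6 : ∀ y, y = x → ∀ w : TangentSpace (PhaseModel n) y, w = Ω.hamiltonianVectorField H y →
      (⟨x, Ω.hamiltonianVectorField H x⟩ : TangentBundle (PhaseModel n) M) = ⟨y, w⟩ := by
    rintro y rfl w rfl; rfl
  exact h6 _ (hφ.start x) _ h5

/-- Both sides are integral curves in t with the same value at t = 0. -/
theorem apply_apply [T2Space M] (hφ : Ω.IsHamiltonianFlow H φ) (s t : ℝ) (x : M) :
    φ t (φ s x) = φ (t + s) x := by
  have h := isMIntegralCurve_Ioo_eq_of_contMDiff_boundaryless (t₀ := 0)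
    (hφ.contMDiff_hamiltonianVectorField.of_le (by simp)) (hφ.integralCurve (φ s x))
    ((hφ.integralCurve x).comp_add s) (by simp [hφ.start])
  exact congrFun h t

/-- The time-`t` map of a Hamiltonian flow as a homeomorphism. -/
def homeomorph [T2Space M] (hφ : Ω.IsHamiltonianFlow H φ) (t : ℝ) : M ≃ₜ M where
  toFun := φ t
  invFun := φ (-t)
  left_inv x := by rw [hφ.apply_apply, neg_add_cancel, hφ.start]
  right_inv x := by rw [hφ.apply_apply, add_neg_cancel, hφ.start]
  continuous_toFun := (hφ.contMDiff_apply t).continuous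
  continuous_invFun := (hφ.contMDiff_apply (-t)).continuous

theorem contMDiffAt_comp_extChartAt_symm (hφ : Ω.IsHamiltonianFlow H φ) {p : M}
    {z : ℝ × PhaseSpace n} (hz : z.2 ∈ (extChartAt (PhaseModel n) p).target) :
    ContMDiffAt 𝓘(ℝ, ℝ × PhaseSpace n) (PhaseModel n) ∞
      (fun y : ℝ × PhaseSpace n => φ y.1 ((extChartAt (PhaseModel n) p).symm y.2)) z := by
  have h1 : ContMDiffAt 𝓘(ℝ, ℝ × PhaseSpace n) (PhaseModel n) ∞
      (fun y : ℝ × PhaseSpace n => (extChartAt (PhaseModel n) p).symm y.2) z :=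
    ((contMDiffOn_extChartAt_symm p).contMDiffAt
      ((isOpen_extChartAt_target p).mem_nhds hz)).comp z contDiff_snd.contMDiff.contMDiffAt
  exact hφ.smooth.contMDiffAt.comp z
    ((contDiff_fst.contMDiff.contMDiffAt : ContMDiffAt 𝓘(ℝ, ℝ × PhaseSpace n) 𝓘(ℝ, ℝ) ∞
      (fun y : ℝ × PhaseSpace n => y.1) z).prodMk h1)

theorem mfderiv_comp_extChartAt_symm_one_zero (hφ : Ω.IsHamiltonianFlow H φ) {p : M}
    {z : ℝ × PhaseSpace n} (hz : z.2 ∈ (extChartAt (PhaseModel n) p).target) :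
    mfderiv 𝓘(ℝ, ℝ × PhaseSpace n) (PhaseModel n)
      (fun y : ℝ × PhaseSpace n => φ y.1 ((extChartAt (PhaseModel n) p).symm y.2)) z
      ((1, 0) : ℝ × PhaseSpace n) =
    Ω.hamiltonianVectorField H (φ z.1 ((extChartAt (PhaseModel n) p).symm z.2)) := by
  have hg := ((hφ.contMDiffAt_comp_extChartAt_symm hz).mdifferentiableAt (by simp)).hasMFDerivAt
  have hι : HasFDerivAt (fun τ : ℝ => (τ, z.2)) (ContinuousLinearMap.inl ℝ ℝ (PhaseSpace n)) z.1 :=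
    hasFDerivAt_prodMk_left z.1 z.2
  have h := hasMFDerivAt_unique (HasMFDerivAt.comp z.1 hg hι.hasMFDerivAt)
    (hφ.integralCurve ((extChartAt (PhaseModel n) p).symm z.2) z.1)
  exact (DFunLike.congr_fun h (1 : ℝ)).trans (one_smul ℝ _)

theorem mfderiv_comp_extChartAt_symm_zero (hφ : Ω.IsHamiltonianFlow H φ) {p : M}
    {z : ℝ × PhaseSpace n} (hz : z.2 ∈ (extChartAt (PhaseModel n) p).target) (a : PhaseSpace n) :
    mfderiv 𝓘(ℝ, ℝ × PhaseSpace n) (PhaseModel n)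
      (fun y : ℝ × PhaseSpace n => φ y.1 ((extChartAt (PhaseModel n) p).symm y.2)) z
      ((0, a) : ℝ × PhaseSpace n) =
    mfderiv (PhaseModel n) (PhaseModel n) (φ z.1) ((extChartAt (PhaseModel n) p).symm z.2)
      (mfderiv (PhaseModel n) (PhaseModel n) (extChartAt (PhaseModel n) p).symm z.2 a) := by
  have hg := ((hφ.contMDiffAt_comp_extChartAt_symm hz).mdifferentiableAt (by simp)).hasMFDerivAt
  have hι : HasFDerivAt (fun u : PhaseSpace n => (z.1, u))
      (ContinuousLinearMap.inr ℝ ℝ (PhaseSpace n)) z.2 := hasFDerivAt_prodMk_right z.1 z.2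
  have h2 := HasMFDerivAt.comp z.2
    (((hφ.contMDiff_apply z.1).mdifferentiable (by simp)) _).hasMFDerivAt
    (mdifferentiableAt_extChartAt_symm hz).hasMFDerivAt
  have h := hasMFDerivAt_unique (HasMFDerivAt.comp z.2 hg hι.hasMFDerivAt) h2
  exact DFunLike.congr_fun h a

/-- Pull Ω back by g(τ, u) = φ_τ(chart⁻¹ u). The result W is closed, and g maps ∂_τ to the
Hamiltonian field, so the contraction of W with ∂_τ is d(H ∘ g). The chart at the time-t image stays
usable for nearby τ. -/
theorem hasDerivAt_toForm_extChartAt_symm (hφ : Ω.IsHamiltonianFlow H φ)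
    (hH : ContMDiff (PhaseModel n) 𝓘(ℝ, ℝ) ∞ H) {p : M} {u : PhaseSpace n}
    (hu : u ∈ (extChartAt (PhaseModel n) p).target) (a b : PhaseSpace n) (t : ℝ) :
    HasDerivAt (fun τ => Ω.toForm (φ τ ((extChartAt (PhaseModel n) p).symm u))
      ![mfderiv (PhaseModel n) (PhaseModel n) (φ τ) ((extChartAt (PhaseModel n) p).symm u)
          (mfderiv (PhaseModel n) (PhaseModel n) (extChartAt (PhaseModel n) p).symm u a),
        mfderiv (PhaseModel n) (PhaseModel n) (φ τ) ((extChartAt (PhaseModel n) p).symm u)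
          (mfderiv (PhaseModel n) (PhaseModel n) (extChartAt (PhaseModel n) p).symm u b)]) 0 t := by
  let q := φ t ((extChartAt (PhaseModel n) p).symm u)
  let g : ℝ × PhaseSpace n → M := fun y => φ y.1 ((extChartAt (PhaseModel n) p).symm y.2)
  let G : ℝ × PhaseSpace n → PhaseSpace n := fun y => extChartAt (PhaseModel n) q (g y)
  let K : ℝ × PhaseSpace n → ℝ := fun y => H (g y)
  let W : ℝ × PhaseSpace n → (ℝ × PhaseSpace n) [⋀^Fin 2]→L[ℝ] ℝ := fun y =>
    (formInChart Ω.toForm q (G y)).compContinuousLinearMap (fderiv ℝ G y)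
  let z : ℝ × PhaseSpace n := (t, u)
  have hq : g z ∈ (extChartAt (PhaseModel n) q).source := mem_extChartAt_source q
  have hg : ∀ y : ℝ × PhaseSpace n, y.2 ∈ (extChartAt (PhaseModel n) p).target →
      ContMDiffAt 𝓘(ℝ, ℝ × PhaseSpace n) (PhaseModel n) ∞ g y :=
    fun y hy => hφ.contMDiffAt_comp_extChartAt_symm hy
  have hnhds : ∀ᶠ y in 𝓝 z, y.2 ∈ (extChartAt (PhaseModel n) p).target ∧
      g y ∈ (extChartAt (PhaseModel n) q).source := by
    have h1 : ∀ᶠ y in 𝓝 z, y.2 ∈ (extChartAt (PhaseModel n) p).target :=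
      continuous_snd.continuousAt.eventually ((isOpen_extChartAt_target p).mem_nhds hu)
    exact h1.and ((hg z hu).continuousAt.eventually ((isOpen_extChartAt_source q).mem_nhds hq))
  have hG : ContDiffAt ℝ ∞ G z := by
    rw [← contMDiffAt_iff_contDiffAt]
    exact (contMDiffAt_extChartAt (x := q)).comp z (hg z hu)
  have htwo : (2 : WithTop ℕ∞) ≤ ∞ := WithTop.coe_le_coe.2 (le_top : (2 : ℕ∞) ≤ ⊤)
  have hK : ContDiffAt ℝ 2 K z := by
    have h : ContMDiffAt 𝓘(ℝ, ℝ × PhaseSpace n) 𝓘(ℝ, ℝ) ∞ K z := hH.contMDiffAt.comp z (hg z hu)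
    exact (contMDiffAt_iff_contDiffAt.1 h).of_le htwo
  have hGz : G z ∈ (extChartAt (PhaseModel n) q).target := mem_extChartAt_target q
  have hω : DifferentiableAt ℝ (formInChart Ω.toForm q) (G z) :=
    ((Ω.smooth q).contDiffAt ((isOpen_extChartAt_target q).mem_nhds hGz)).differentiableAt (by simp)
  have hW : DifferentiableAt ℝ W z :=
    (hω.comp z (hG.differentiableAt (by simp))).continuousAlternatingMapCompContinuousLinearMap
      (((hG.of_le htwo).fderiv_right (m := 1) (by norm_num)).differentiableAt (by simp))
  have hclosed : extDeriv W z = 0 := by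
    rw [extDeriv_pullback hω hG (by simpa using htwo), Ω.closed q _ hGz]
    rfl
  have hWapply : ∀ᶠ y in 𝓝 z, ∀ V V', W y ![V, V'] = Ω.toForm (g y)
      ![mfderiv 𝓘(ℝ, ℝ × PhaseSpace n) (PhaseModel n) g y V,
        mfderiv 𝓘(ℝ, ℝ × PhaseSpace n) (PhaseModel n) g y V'] := by
    filter_upwards [hnhds] with y hy V V'
    have hgy := (hg y hy.1).mdifferentiableAt (by simp)
    have h1 : W y ![V, V'] = formInChart Ω.toForm q (G y) ![fderiv ℝ G y V, fderiv ℝ G y V'] := by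
      change formInChart Ω.toForm q (G y) (fun i => fderiv ℝ G y (![V, V'] i)) = _
      congr 1
      funext i
      fin_cases i <;> rfl
    exact h1.trans <| (formInChart_apply _ _ _ _ _).trans <| Ω.toForm_congr
      ((extChartAt (PhaseModel n) q).left_inv hy.2) (mfderiv_symm_comp_fderiv hgy hy.2 V)
      (mfderiv_symm_comp_fderiv hgy hy.2 V')
  have hX : ∀ᶠ y in 𝓝 z, ∀ Y, W y ![(1, 0), Y] = fderiv ℝ K y Y := by
    filter_upwards [hnhds, hWapply] with y hy hWy Y
    have hgy := (hg y hy.1).mdifferentiableAt (by simp)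
    have h1 := mfderiv_comp y (hH.mdifferentiable (by simp) (g y)) hgy
    rw [hWy, ← mfderiv_eq_fderiv]
    exact (Ω.toForm_congr rfl (hφ.mfderiv_comp_extChartAt_symm_one_zero hy.1) rfl).trans
      ((Ω.toForm_hamiltonianVectorField H (g y) _).trans (DFunLike.congr_fun h1 Y).symm)
  have h0 := fderiv_apply_eq_zero_of_extDeriv_eq_zero hW hK hclosed hX (0, a) (0, b)
  have hd : DifferentiableAt ℝ (fun y => W y ![((0 : ℝ), a), (0, b)]) z :=
    hW.continuousAlternatingMap_apply fun _ => differentiableAt_const _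
  have hι : HasDerivAt (fun τ : ℝ => (τ, u)) ((1 : ℝ), (0 : PhaseSpace n)) t :=
    (hasDerivAt_id t).prodMk (hasDerivAt_const t u)
  have h1 := HasFDerivAt.comp_hasDerivAt t hd.hasFDerivAt hι
  rw [h0] at h1
  refine h1.congr_of_eventuallyEq ?_
  have hev := hι.continuousAt.eventually (hnhds.and hWapply)
  filter_upwards [hev] with τ hτ
  refine (Ω.toForm_congr rfl ?_ ?_).trans (hτ.2 (0, a) (0, b)).symm
  · exact (hφ.mfderiv_comp_extChartAt_symm_zero (z := (τ, u)) hτ.1.1 a).symm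
  · exact (hφ.mfderiv_comp_extChartAt_symm_zero (z := (τ, u)) hτ.1.1 b).symm

theorem hasDerivAt_toForm (hφ : Ω.IsHamiltonianFlow H φ) (hH : ContMDiff (PhaseModel n) 𝓘(ℝ, ℝ) ∞ H)
    (x : M) (a b : TangentSpace (PhaseModel n) x) (t : ℝ) :
    HasDerivAt (fun τ => Ω.toForm (φ τ x) ![mfderiv (PhaseModel n) (PhaseModel n) (φ τ) x a,
      mfderiv (PhaseModel n) (PhaseModel n) (φ τ) x b]) 0 t := by
  obtain ⟨p, u, hu, rfl⟩ : ∃ p : M, ∃ u ∈ (extChartAt (PhaseModel n) p).target,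
      (extChartAt (PhaseModel n) p).symm u = x :=
    ⟨x, _, mem_extChartAt_target x, extChartAt_to_inv x⟩
  obtain ⟨L, hL⟩ := isInvertible_mfderiv_extChartAt_symm hu
  have h := hφ.hasDerivAt_toForm_extChartAt_symm hH hu (L.symm a) (L.symm b) t
  have hs : ∀ w, mfderiv (PhaseModel n) (PhaseModel n) (extChartAt (PhaseModel n) p).symm u
      (L.symm w) = w := fun w => by
    rw [← hL]
    exact L.apply_symm_apply w
  rwa [hs, hs] at h

theorem isSymplecticMap (hφ : Ω.IsHamiltonianFlow H φ) (hH : ContMDiff (PhaseModel n) 𝓘(ℝ, ℝ) ∞ H)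
    (t : ℝ) : Ω.IsSymplecticMap (φ t) where
  contMDiff := hφ.contMDiff_apply t
  toForm_mfderiv x a b := by
    have h := is_const_of_deriv_eq_zero
      (fun τ => (hφ.hasDerivAt_toForm hH x a b τ).differentiableAt)
      (fun τ => (hφ.hasDerivAt_toForm hH x a b τ).deriv) t 0
    refine h.trans ?_
    have h0 : φ 0 = fun y => y := funext hφ.start
    rw [h0]
    exact (SymplecticForm.IsSymplecticMap.id Ω).toForm_mfderiv x a b

theorem measurePreserving [T2Space M] [SecondCountableTopology M] [MeasurableSpace M] [BorelSpace M]
    (hφ : Ω.IsHamiltonianFlow H φ) (hH : ContMDiff (PhaseModel n) 𝓘(ℝ, ℝ) ∞ H) (t : ℝ) :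
    MeasurePreserving (φ t) Ω.liouvilleMeasure Ω.liouvilleMeasure := by
  have h : Ω.IsSymplecticMap (hφ.homeomorph t) := hφ.isSymplecticMap hH t
  exact h.measurePreserving

end SymplecticForm.IsHamiltonianFlow

end HamiltonianFlow

/-! ### Duality, uniqueness and hybrid states -/

section Duality

variable {n N : ℕ} {M : Type*} [TopologicalSpace M] [ChartedSpace (PhaseSpace n) M]
  [IsManifold (PhaseModel n) ∞ M] [T2Space M] [SecondCountableTopology M]
  [MeasurableSpace M] [BorelSpace M] {Ω : SymplecticForm n M}
  {A : M → Type*} [∀ x, Ring (A x)] [∀ x, Algebra ℂ (A x)] [∀ x, StarRing (A x)]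
  [∀ x, StarModule ℂ (A x)] [∀ x, TopologicalSpace (A x)]
  [∀ x, IsTopologicalAddGroup (A x)] [∀ x, ContinuousSMul ℝ (A x)]
  [TopologicalSpace (TotalSpace (EndC N) A)] [FiberBundle (EndC N) A]
  [VectorBundle ℝ (EndC N) A] [ContMDiffVectorBundle ∞ (EndC N) A (PhaseModel n)]
  {cov : CovariantDerivative (PhaseModel n) (EndC N) A} {H₀ : M → ℝ} {H₁ : Observables n N A}
  {φ : ℝ → M → M} {Φ : ℝ → Observables n N A → Observables n N A}

theorem fiberTrace_star_mul_self_nonneg (hA : IsStarAlgebraBundle N A) (x : M) (a : A x) :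
    0 ≤ (fiberTrace N x (star a * a)).re := by
  rw [fiberTrace_eq hA (mem_frameNhd x), coordAt_mul hA (mem_frameNhd x),
    coordAt_star hA (mem_frameNhd x)]
  exact (endTrace_star_mul_self_nonneg _).1

theorem fiberTrace_star_mul_self_im (hA : IsStarAlgebraBundle N A) (x : M) (a : A x) :
    (fiberTrace N x (star a * a)).im = 0 := by
  rw [fiberTrace_eq hA (mem_frameNhd x), coordAt_mul hA (mem_frameNhd x),
    coordAt_star hA (mem_frameNhd x)]
  exact (endTrace_star_mul_self_nonneg _).2

/-- A section that is orthogonal to all compactly supported sections vanishes. -/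
theorem eq_of_expectation_eq (hA : IsStarAlgebraBundle N A) {ρ ρ' : Observables n N A}
    (h : ∀ s : Observables n N A, HasCompactSupport (fun x => fiberTrace N x (s x * ρ x)) →
      HasExpectation Ω ρ' s ∧ expectation Ω ρ' s = expectation Ω ρ s) : ρ' = ρ := by
  have := Manifold.locallyCompact_of_finiteDimensional (M := M) (PhaseModel n)
  ext x
  by_contra hne
  obtain ⟨χ⟩ : Nonempty (SmoothBumpFunction (PhaseModel n) x) := inferInstance
  let d : Observables n N A := ρ' - ρ
  -- With this test section, Tr(s d) = χ Tr(d*d) is nonnegative, and at x, where χ = 1, it vanishes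
  -- only if d x = 0.
  let s : Observables n N A := ⟨(χ : M → ℝ) • fun y => starObservable hA d y,
    ContMDiff.smul_section χ.contMDiff (starObservable hA d).contMDiff⟩
  have hs : ∀ (σ : Observables n N A) y, fiberTrace N y (s y * σ y) =
      (χ y : ℂ) * fiberTrace N y (star (d y) * σ y) := by
    intro σ y
    change fiberTrace N y ((χ y • star (d y)) * σ y) = _
    rw [← Complex.coe_smul, smul_mul_assoc, fiberTrace_smul hA]
  have hcs : ∀ σ : Observables n N A, HasCompactSupport fun y => fiberTrace N y (s y * σ y) := by
    intro σ
    refine χ.hasCompactSupport.mono fun y hy hχ => hy ?_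
    change fiberTrace N y (s y * σ y) = 0
    rw [hs, hχ, Complex.ofReal_zero, zero_mul]
  obtain ⟨h1, h2⟩ := h s (hcs ρ)
  have h3 : Integrable (fun y => fiberTrace N y (s y * ρ y)) Ω.liouvilleMeasure :=
    (continuous_fiberTrace_mul hA s ρ).integrable_of_hasCompactSupport (hcs ρ)
  have h4 : ∀ y, fiberTrace N y (s y * ρ' y) - fiberTrace N y (s y * ρ y) =
      fiberTrace N y (s y * d y) := fun y => by
    rw [← fiberTrace_sub hA, ← mul_sub]
    rfl
  have h5 : ∫ y, fiberTrace N y (s y * d y) ∂Ω.liouvilleMeasure = 0 := by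
    simp_rw [← h4]
    rw [integral_sub h1 h3]
    exact sub_eq_zero.2 h2
  have hcont := continuous_fiberTrace_mul hA s d
  have h6 : ∫ y, (fiberTrace N y (s y * d y)).re ∂Ω.liouvilleMeasure = 0 := by
    have h7 := integral_re (hcont.integrable_of_hasCompactSupport (μ := Ω.liouvilleMeasure) (hcs d))
    rw [h5] at h7
    simpa using h7
  have hre : ∀ y, (fiberTrace N y (s y * d y)).re = χ y * (fiberTrace N y (star (d y) * d y)).re := by
    intro y
    rw [hs, Complex.re_ofReal_mul]
  have h7 : (fun y => (fiberTrace N y (s y * d y)).re) = 0 := by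
    have hint : Integrable (fun y => (fiberTrace N y (s y * d y)).re) Ω.liouvilleMeasure :=
      (hcont.integrable_of_hasCompactSupport (hcs d)).re
    have hnn : 0 ≤ fun y => (fiberTrace N y (s y * d y)).re := fun y => by
      change (0 : ℝ) ≤ (fiberTrace N y (s y * d y)).re
      rw [hre]
      exact mul_nonneg χ.nonneg (fiberTrace_star_mul_self_nonneg hA y _)
    exact ((Complex.continuous_re.comp hcont).ae_eq_iff_eq Ω.liouvilleMeasure continuous_const).1
      ((integral_eq_zero_iff_of_nonneg hnn hint).1 h6)
  have h8 := congrFun h7 x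
  simp only [hre, χ.eq_one, one_mul, Pi.zero_apply] at h8
  have h9 : d x = 0 := eq_zero_of_fiberTrace_star_mul_self hA
    (Complex.ext h8 (fiberTrace_star_mul_self_im hA x (d x)))
  exact hne (sub_eq_zero.1 h9)

section Evolution

variable (hA : IsStarAlgebraBundle N A) (hcov : IsStarConnection cov)
  (hφ : Ω.IsHamiltonianFlow H₀ φ) (hH₀ : ContMDiff (PhaseModel n) 𝓘(ℝ, ℝ) ∞ H₀)

include hA hcov hφ hH₀

theorem IsTimeEvolution.hasExpectation_iff (hΦ : IsTimeEvolution Ω cov H₀ H₁ Φ) (t : ℝ)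
    (s ρ : Observables n N A) :
    HasExpectation Ω (Φ (-t) ρ) s ↔ HasExpectation Ω ρ (Φ t s) := by
  have h := (hφ.measurePreserving hH₀ t).integrable_comp_emb
    (hφ.homeomorph t).measurableEmbedding (g := fun y => fiberTrace N y (s y * Φ (-t) ρ y))
  refine h.symm.trans ?_
  simp only [Function.comp_def, hΦ.fiberTrace_mul hA hcov hφ t s ρ]
  rfl

theorem IsTimeEvolution.expectation_eq (hΦ : IsTimeEvolution Ω cov H₀ H₁ Φ) (t : ℝ)
    (s ρ : Observables n N A) :
    expectation Ω (Φ (-t) ρ) s = expectation Ω ρ (Φ t s) := by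
  have h := (hφ.measurePreserving hH₀ t).integral_comp
    (hφ.homeomorph t).measurableEmbedding (fun y => fiberTrace N y (s y * Φ (-t) ρ y))
  refine h.symm.trans ?_
  simp only [hΦ.fiberTrace_mul hA hcov hφ t s ρ]
  rfl

theorem IsTimeEvolution.isDualEvolution (hΦ : IsTimeEvolution Ω cov H₀ H₁ Φ)
    (ρ : Observables n N A) : IsDualEvolution Ω Φ ρ fun t => Φ (-t) ρ := fun t s h =>
  ⟨(hΦ.hasExpectation_iff hA hcov hφ hH₀ t s ρ).2 h, hΦ.expectation_eq hA hcov hφ hH₀ t s ρ⟩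

/-- Compact support of Tr(s Φ(-t)ρ) makes that expectation defined;
`IsTimeEvolution.hasExpectation_iff` transfers this to the right-hand side of the duality, so the
condition on r applies to such s. -/
theorem IsDualEvolution.eq (hΦ : IsTimeEvolution Ω cov H₀ H₁ Φ) {ρ : Observables n N A}
    {r : ℝ → Observables n N A} (hr : IsDualEvolution Ω Φ ρ r) : r = fun t => Φ (-t) ρ := by
  funext t
  refine eq_of_expectation_eq (Ω := Ω) hA fun s hs => ?_
  have h : HasExpectation Ω (Φ (-t) ρ) s :=
    (continuous_fiberTrace_mul hA s (Φ (-t) ρ)).integrable_of_hasCompactSupport hs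
  obtain ⟨h1, h2⟩ := hr t s ((hΦ.hasExpectation_iff hA hcov hφ hH₀ t s ρ).1 h)
  exact ⟨h1, h2.trans (hΦ.expectation_eq hA hcov hφ hH₀ t s ρ).symm⟩

theorem IsTimeEvolution.isHybridState (hΦ : IsTimeEvolution Ω cov H₀ H₁ Φ)
    (hH₁ : ∀ x, star (H₁ x) = H₁ x) {ρ : Observables n N A} (hρ : IsHybridState Ω ρ) (t : ℝ) :
    IsHybridState Ω (Φ (-t) ρ) where
  selfAdjoint := hΦ.star_eq hA hcov hφ hH₁ (-t) hρ.selfAdjoint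
  nonneg x c hc := hρ.nonneg _ c (hΦ.spectrum_subset hA hcov hφ hH₁ t ρ x hc)
  normalized := by
    have h := (hφ.measurePreserving hH₀ t).integral_comp
      (hφ.homeomorph t).measurableEmbedding (fun y => fiberTrace N y (Φ (-t) ρ y))
    simp only [hΦ.fiberTrace_neg hA hcov hφ t ρ, hρ.normalized] at h
    exact h.symm

end Evolution

end Duality

end

theorem mainTheorem9 {n N : ℕ} {M : Type*} [TopologicalSpace M] [ChartedSpace (PhaseSpace n) M]
    [IsManifold (PhaseModel n) ∞ M] [T2Space M] [SecondCountableTopology M]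
    [MeasurableSpace M] [BorelSpace M]
    (Ω : SymplecticForm n M)
    {A : M → Type*} [∀ x, Ring (A x)] [∀ x, Algebra ℂ (A x)] [∀ x, StarRing (A x)]
    [∀ x, StarModule ℂ (A x)] [∀ x, TopologicalSpace (A x)]
    [∀ x, IsTopologicalAddGroup (A x)] [∀ x, ContinuousSMul ℝ (A x)]
    [TopologicalSpace (TotalSpace (EndC N) A)] [FiberBundle (EndC N) A]
    [VectorBundle ℝ (EndC N) A] [ContMDiffVectorBundle ∞ (EndC N) A (PhaseModel n)]
    (hA : IsStarAlgebraBundle N A)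
    (cov : CovariantDerivative (PhaseModel n) (EndC N) A)
    [CovariantDerivative.ContMDiffCovariantDerivative cov ∞]
    (hcov : IsStarConnection cov)
    (H₀ : M → ℝ) (hH₀ : ContMDiff (PhaseModel n) 𝓘(ℝ, ℝ) ∞ H₀)
    (H₁ : Observables n N A) (hH₁ : ∀ x, star (H₁ x) = H₁ x)
    (φ : ℝ → M → M) (hφ : Ω.IsHamiltonianFlow H₀ φ)
    (Φ : ℝ → Observables n N A → Observables n N A) (hΦ : IsTimeEvolution Ω cov H₀ H₁ Φ)
    (U : ℝ → Observables n N A) (hU : IsEvolutionOperator Ω cov H₀ H₁ U)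
    (ρ : Observables n N A) (hρ : IsHybridState Ω ρ) :
    (∃! r : ℝ → Observables n N A, IsDualEvolution Ω Φ ρ r) ∧
    ∀ r : ℝ → Observables n N A, IsDualEvolution Ω Φ ρ r →
      r 0 = ρ ∧
      (∀ t, IsHybridState Ω (r t)) ∧
      IsSmoothFamily r ∧
      (∀ t x, HasDerivAt (fun τ => r τ x)
        (-hybridBracket Ω cov H₀ (r t) x -
          Complex.I • (H₁ x * r t x - r t x * H₁ x)) t) ∧
      (∀ t x, IsUnit (U t x)) ∧
      ∀ t y, TotalSpace.mk' (EndC N) y (r t y) =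
        TotalSpace.mk' (EndC N) (φ 0 y)
          (parallelTransport cov (fun τ => φ τ y) (-t) 0
            (Ring.inverse (U t (φ (-t) y)) * ρ (φ (-t) y) * U t (φ (-t) y))) := by
  refine ⟨⟨fun t => Φ (-t) ρ, hΦ.isDualEvolution hA hcov hφ hH₀ ρ,
    fun r hr => hr.eq hA hcov hφ hH₀ hΦ⟩, fun r hr => ?_⟩
  rw [hr.eq hA hcov hφ hH₀ hΦ]
  exact ⟨by simp [hΦ.start], hΦ.isHybridState hA hcov hφ hH₀ hH₁ hρ, (hΦ.smooth ρ).comp_neg,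
    hΦ.hasDerivAt_neg ρ, hU.isUnit hA hcov hφ hH₁, hΦ.eq_parallelTransport hA hcov hφ hH₁ hU ρ⟩
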